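/- All digraphs are finite and may have multiple arcs but no loops. Let $D=(V+x,A)$ be a digraph with vertex set $V+x=V\cup\{x\}$, where $x\notin V$, and arc set $A$. An $x$-arborescence in $D$ is a (not necessarily spanning) subdigraph $F$ of $D$ that contains $x$, whose underlying graph is a tree, and in which every $u\in V(F)$ is reached from $x$ by exactly one directed path of $F$. A subdigraph is identified with its arc set where convenient. For $B\subseteq A$, $X\subseteq V$ and $u\in V$, let $d^-_B(X)$ be the number of arcs of $B$ with head in $X$ and tail not in $X$, let $[x,u]_B$ be the number of arcs of $B$ from $x$ to $u$, and let $d^+_F(x)$ be the number of arcs of $F$ with tail $x$; $E^+(x)$ is the set of arcs of $A$ with tail $x$, and $N^+(x)$ is the set of their heads. Let $k>0$ be an integer, let $\{I_1,\dots,I_l\}$ be a partition of $[k]=\{1,\dots,k\}$ into nonempty parts, and let $c_1,\dots,c_l,c'_1,\dots,c'_l$ be nonnegative integers with $c_\alpha\le c'_\alpha$ for $1\le\alpha\le l$. Let $F_1,\dots,F_k$ be pairwise arc-disjoint $x$-arborescences in $D$ with $\sum_{i\in I_\alpha}d^+_{F_i}(x)\le c'_\alpha$ for $1\le\alpha\le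 l$. For $I\subseteq[k]$ write $\overline I=[k]\setminus I$; for $X\subseteq V$ put $P_I(X)=\{i\in I: X\cap V(F_i)=\emptyset\}$; for $u\in V$ put $w_I(u)=\min\{|\{i\in I:u\notin V(F_i)\}|,\ [x,u]_{A\setminus\bigcup_{i=1}^kF_i}\}$ if $u\in N^+(x)$ and $w_I(u)=0$ otherwise; and put $\widetilde w_I(X)=\sum_{u\in X}w_I(u)$. **Theorem.** There exist pairwise arc-disjoint spanning $x$-arborescences $F^*_1,\dots,F^*_k$ in $D$ such that $F_i$ is a subdigraph of $F^*_i$ for $1\le i\le k$ and $$c_\alpha\le\sum_{i\in I_\alpha}d^+_{F^*_i}(x)\le c'_\alpha\qquad(1\le\alpha\le l)$$ if and only if, for every $t\ge 0$, all pairwise disjoint nonempty sets $X_1,\dots,X_t\subseteq V$, and every $I\subseteq[k]$ that is the union of some (possibly none) of $I_1,\dots,I_l$, both of the following hold: (i) $\displaystyle\sum_{j=1}^{t}d^-_{A\setminus\bigcup_{i=1}^kF_i}(X_j)\ \ge\ \sum_{j=1}^{t}|P_I(X_j)|+\sum_{I_\alpha\subseteq\overline I}\Bigl(c_\alpha-\sum_{i\in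 I_\alpha}d^+_{F_i}(x)\Bigr)-\widetilde w_{\overline I}\Bigl(V\setminus\bigcup_{j=1}^{t}X_j\Bigr);$ (ii) $\displaystyle\sum_{j=1}^{t}\Bigl(|P_I(X_j)|-d^-_{A\setminus(\bigcup_{i=1}^kF_i\,\cup\,E^+(x))}(X_j)\Bigr)\ \le\ \sum_{I_\alpha\subseteq I}\Bigl(c'_\alpha-\sum_{i\in I_\alpha}d^+_{F_i}(x)\Bigr).$ -/

import Mathlib

/-- A digraph with vertex set `W` and arc set `A`; multiple arcs are allowed, loops are not. -/
structure MultiDigraph (W A : Type*) where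
  tail : A → W
  head : A → W
  tail_ne_head : ∀ a, tail a ≠ head a

namespace MultiDigraph

variable {W A : Type*}

/-- A subdigraph: a set of vertices and a set of arcs having both ends among these vertices. -/
structure Sub (D : MultiDigraph W A) where
  verts : Finset W
  arcs : Finset A
  tail_mem : ∀ a ∈ arcs, D.tail a ∈ verts
  head_mem : ∀ a ∈ arcs, D.head a ∈ verts

/-- The sequence of arcs `p` is a directed walk from `r` to `u`. -/
def IsWalk (D : MultiDigraph W A) : W → List A → W → Prop
  | r, [], u => r = u
  | r, a :: p, u => D.tail a = r ∧ D.IsWalk (D.head a) p u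

namespace Sub

variable {D : MultiDigraph W A}

/-- `p` is the arc sequence of a directed path from `r` to `u` in `F`: a directed walk
using arcs of `F` and visiting no vertex twice. -/
def IsPath (F : D.Sub) (r : W) (p : List A) (u : W) : Prop :=
  D.IsWalk r p u ∧ (∀ a ∈ p, a ∈ F.arcs) ∧ (r :: p.map D.head).Nodup

/-- The simple graph on the vertices of `F` obtained by forgetting directions and
multiplicities of arcs. -/
def simpleGraph (F : D.Sub) : SimpleGraph {v // v ∈ F.verts} where
  Adj u v := ∃ a ∈ F.arcs,
    (D.tail a = u ∧ D.head a = v) ∨ (D.tail a = v ∧ D.head a = u)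
  symm := ⟨fun _ _ ⟨a, ha, h⟩ => ⟨a, ha, h.symm⟩⟩
  loopless := ⟨by
    rintro u ⟨a, _, ⟨h₁, h₂⟩ | ⟨h₁, h₂⟩⟩ <;> exact D.tail_ne_head a (h₁.trans h₂.symm)⟩

/-- The underlying undirected multigraph of `F` is a tree: no two distinct arcs have the
same pair of ends (they would form a cycle of length two), and the underlying simple graph
is connected and acyclic. -/
def IsUnderlyingTree (F : D.Sub) : Prop :=
  (∀ a ∈ F.arcs, ∀ b ∈ F.arcs, s(D.tail a, D.head a) = s(D.tail b, D.head b) → a = b) ∧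
    F.simpleGraph.IsTree

/-- `F` is an `r`-arborescence (not necessarily spanning). -/
def IsArborescence (F : D.Sub) (r : W) : Prop :=
  r ∈ F.verts ∧ F.IsUnderlyingTree ∧ ∀ u ∈ F.verts, ∃! p : List A, F.IsPath r p u

/-- `F` contains all vertices of the digraph. -/
def IsSpanning (F : D.Sub) : Prop := ∀ v : W, v ∈ F.verts

/-- `F` is a subdigraph of `G`. -/
def IsSubOf (F G : D.Sub) : Prop := F.verts ⊆ G.verts ∧ F.arcs ⊆ G.arcs

end Sub

section Counting

variable [DecidableEq W]

/-- `[X, Y]` in the arc set `B`: the number of arcs of `B` with tail in `X` and head in `Y`. -/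
def numArcs (D : MultiDigraph W A) (B : Finset A) (X Y : Finset W) : ℕ :=
  (B.filter fun a => D.tail a ∈ X ∧ D.head a ∈ Y).card

/-- The set of arcs of `B` with tail `x`. -/
def outArcs (D : MultiDigraph W A) (B : Finset A) (x : W) : Finset A :=
  B.filter fun a => D.tail a = x

/-- The set of heads of the arcs of `B` with tail `x`. -/
def outNbrs (D : MultiDigraph W A) (B : Finset A) (x : W) : Finset W :=
  (D.outArcs B x).image D.head

variable [Fintype W]

/-- In-degree of the vertex set `X` with respect to the arc set `B`. -/
def inDeg (D : MultiDigraph W A) (B : Finset A) (X : Finset W) : ℕ := D.numArcs B Xᶜ X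

/-- Out-degree of the vertex `x` with respect to the arc set `B`. -/
def outDeg (D : MultiDigraph W A) (B : Finset A) (x : W) : ℕ := D.numArcs B {x} {x}ᶜ

end Counting

section Families

variable [DecidableEq W] [DecidableEq A] {D : MultiDigraph W A} {k : ℕ}

/-- The members of the family are pairwise arc-disjoint. -/
def ArcDisjoint (F : Fin k → D.Sub) : Prop :=
  ∀ i j, i ≠ j → Disjoint (F i).arcs (F j).arcs

/-- `P_I(X)`: the indices `i` in `I` for which `F i` has no vertex in `X`. -/
def missing (F : Fin k → D.Sub) (I : Finset (Fin k)) (X : Finset W) : Finset (Fin k) :=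
  I.filter fun i => Disjoint X (F i).verts

variable [Fintype A]

/-- The arcs of `D` that belong to no member of the family. -/
def freeArcs (F : Fin k → D.Sub) : Finset A :=
  Finset.univ \ Finset.univ.biUnion fun i => (F i).arcs

/-- `w_I(u)`: the minimum of the number of `i` in `I` with `u` not in `F i` and the number of
free arcs from `x` to `u` if `u` is an out-neighbour of `x` in `D`, and `0` otherwise. -/
def weight (F : Fin k → D.Sub) (x : W) (I : Finset (Fin k)) (u : W) : ℕ :=
  if u ∈ D.outNbrs Finset.univ x then
    min (I.filter fun i => u ∉ (F i).verts).card (D.numArcs (freeArcs F) {x} {u})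
  else 0

end Families

end MultiDigraph

/-!
Sufficiency goes in two rounds. First every `F i` receives its new arcs with tail `x`; afterwards
only free arcs with tail different from `x` are used, and by the argument of Edmonds' branching
theorem this can be completed to spanning arborescences as soon as every nonempty `X` is entered by
at least as many of these arcs as there are members avoiding `X`.

How many new arcs `x → u` the members of a part `I_α` receive is a matrix with prescribed column
sums, an extra row `none` taking the arcs `x → u` that stay unused. The requirements on its
entries are lower bounds `p S X` on the block sums over rows `S` and columns `X`, where `p` is
supermodular for unions in one argument and intersections in the other. If, moreover, `p` on all
rows and the single column `u` is at least `b u` (here because the row `none` takes every remaining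
arc `x → u`), then a nonnegative integral matrix with row sums `a` and column sums `b`, of equal
total, exists as soon as no packing of disjoint column sets with labels in `S` has total `p`-value
above `∑ α ∈ S, a α`. Conditions (i) and (ii) say exactly that row sums between the given bounds can
be chosen in this way.
-/

section Packing

variable {Λ V : Type*} [DecidableEq V]

/-- There are pairwise disjoint nonempty sets `X₁, …, Xₜ ⊆ U` with labels `T₁, …, Tₜ ⊆ S` such that
`v ≤ ∑ j, p Tⱼ Xⱼ`. Only a lower bound on the value is recorded, so that the predicate is downward
closed in `v`. -/
inductive HasPacking (p : Finset Λ → Finset V → ℤ) (S : Finset Λ) : Finset V → ℤ → Prop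
  | nil {U : Finset V} {v : ℤ} (hv : v ≤ 0) : HasPacking p S U v
  | cons {U : Finset V} {v : ℤ} {T : Finset Λ} {X : Finset V} (hT : T ⊆ S) (hX : X.Nonempty)
      (hXU : X ⊆ U) (h : HasPacking p S (U \ X) (v - p T X)) : HasPacking p S U v

/-- Every packing inside `U` with labels in `S` has value at most `a(S)`. -/
def DominatesPackings (p : Finset Λ → Finset V → ℤ) (U : Finset V) (a : Λ → ℤ) : Prop :=
  ∀ S v, HasPacking p S U v → v ≤ ∑ α ∈ S, a α

namespace HasPacking

variable {p q : Finset Λ → Finset V → ℤ} {S S' T : Finset Λ} {U U' U₂ X Y Z : Finset V}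
  {v v' v₂ : ℤ}

theorem mono (h : HasPacking p S U v) (hS : S ⊆ S') (hU : U ⊆ U') : HasPacking p S' U' v := by
  induction h generalizing U' with
  | nil hv => exact nil hv
  | cons hT hX hXU _ ih =>
    exact cons (hT.trans hS) hX (hXU.trans hU) (ih (Finset.sdiff_subset_sdiff hU subset_rfl))

theorem of_le (h : HasPacking p S U v) (hv : v' ≤ v) : HasPacking p S U v' := by
  induction h generalizing v' with
  | nil h0 => exact nil (hv.trans h0)
  | cons hT hX hXU _ ih => exact cons hT hX hXU (ih (by linarith))

theorem of_value_le (h : HasPacking p S U v) (hpq : ∀ T, ∀ X ⊆ U, p T X ≤ q T X) :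
    HasPacking q S U v := by
  induction h with
  | nil hv => exact nil hv
  | cons hT hX hXU _ ih =>
    exact cons hT hX hXU ((ih fun T Y hY => hpq T Y (hY.trans Finset.sdiff_subset)).of_le
      (sub_le_sub_left (hpq _ _ hXU) _))

theorem single (hT : T ⊆ S) (hX : X.Nonempty) (hXU : X ⊆ U) : HasPacking p S U (p T X) :=
  cons hT hX hXU (nil (sub_self _).le)

theorem add (h : HasPacking p S U v) (h' : HasPacking p S U' v') (hd : Disjoint U U') :
    HasPacking p S (U ∪ U') (v + v') := by
  induction h with
  | nil hv => exact (h'.mono subset_rfl Finset.subset_union_right).of_le (by linarith)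
  | @cons U v T X hT hX hXU _ ih =>
    refine cons hT hX (hXU.trans Finset.subset_union_left)
      (((ih (hd.mono_left Finset.sdiff_subset)).mono subset_rfl ?_).of_le (by linarith))
    rw [Finset.disjoint_left] at hd
    grind

theorem union_of_sdiff (h : HasPacking p S (U \ Z) (v - p T Z)) (hT : T ⊆ S) (hZ : Z.Nonempty) :
    HasPacking p S (U ∪ Z) v :=
  cons hT hZ Finset.subset_union_right (h.mono subset_rfl (by grind))

theorem split_at (h : HasPacking p S U v) (u : V) :
    HasPacking p S (U.erase u) v ∨
      ∃ T X, T ⊆ S ∧ X ⊆ U ∧ u ∈ X ∧ HasPacking p S (U \ X) (v - p T X) := by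
  induction h with
  | nil hv => exact Or.inl (nil hv)
  | @cons U v T X hT hX hXU h ih =>
    by_cases hu : u ∈ X
    · exact Or.inr ⟨T, X, hT, hXU, hu, h⟩
    rcases ih with h₁ | ⟨T', X', hT', hX', hu', h₁⟩
    · exact Or.inl (cons hT hX (by grind) (h₁.mono subset_rfl (by grind)))
    · exact Or.inr ⟨T', X', hT', by grind, hu', cons hT hX (by grind)
        ((h₁.mono subset_rfl (by grind)).of_le (by linarith))⟩

theorem erase (h : HasPacking p S U v) {x : V} (hx : ∀ T X, x ∈ X → p T X ≤ 0) :
    HasPacking p S (U.erase x) v := by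
  rcases h.split_at x with h | ⟨T, X, -, -, hxX, h⟩
  · exact h
  · exact (h.mono subset_rfl (by grind)).of_le (by linarith [hx T X hxX])

theorem singletons {b : V → ℤ} (hb : ∀ v ∈ U, b v ≤ p S {v}) :
    HasPacking p S U (∑ v ∈ U, b v) := by
  induction U using Finset.induction_on with
  | empty => exact nil (by simp)
  | insert z U hz ih =>
    rw [Finset.sum_insert hz]
    refine cons (T := S) (X := {z}) subset_rfl (by simp) (by simp) ?_
    refine ((ih fun v hv => hb v (Finset.mem_insert_of_mem hv)).mono subset_rfl
      (by grind)).of_le ?_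
    linarith [hb z (Finset.mem_insert_self z U)]

end HasPacking

theorem DominatesPackings.mono {p : Finset Λ → Finset V → ℤ} {U U' : Finset V} {a : Λ → ℤ}
    (ha : DominatesPackings p U' a) (hU : U ⊆ U') : DominatesPackings p U a :=
  fun S v h => ha S v (h.mono subset_rfl hU)

theorem DominatesPackings.value_le {p : Finset Λ → Finset V → ℤ} {U X : Finset V} {a : Λ → ℤ}
    {S T : Finset Λ} {v : ℤ} (ha : DominatesPackings p U a) (hT : T ⊆ S) (hX : X.Nonempty)
    (hXU : X ⊆ U) (h : HasPacking p S (U \ X) v) : p T X + v ≤ ∑ α ∈ S, a α :=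
  ha S _ (.cons hT hX hXU (h.of_le (by linarith)))

end Packing

section Uncrossing

variable {Λ V : Type*} [DecidableEq Λ] [DecidableEq V]

/-- Intersecting supermodularity on pairs `(S, X)`, for the order that is increasing in the label
`S` and decreasing in the set `X`. -/
def IsBisupermodular (p : Finset Λ → Finset V → ℤ) : Prop :=
  ∀ S T X Y, (X ∩ Y).Nonempty → p S X + p T Y ≤ p (S ∪ T) (X ∩ Y) + p (S ∩ T) (X ∪ Y)

theorem IsBisupermodular.nonneg_of_nonneg {p : Finset Λ → Finset V → ℤ} (hp : IsBisupermodular p)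
    (hnonpos : ∀ S X, X.Nonempty → p S X ≤ 0) {S T : Finset Λ} {X Y : Finset V}
    (hS : 0 ≤ p S X) (hT : 0 ≤ p T Y) (hXY : (X ∩ Y).Nonempty) :
    0 ≤ p (S ∪ T) (X ∩ Y) ∧ 0 ≤ p (S ∩ T) (X ∪ Y) := by
  have := hp S T X Y hXY
  have := hnonpos (S ∪ T) (X ∩ Y) hXY
  have := hnonpos (S ∩ T) (X ∪ Y) (hXY.mono (Finset.inter_subset_left.trans
    Finset.subset_union_left))
  constructor <;> linarith

namespace HasPacking

variable {p : Finset Λ → Finset V → ℤ} {S S' T : Finset Λ} {U U' U₂ Y : Finset V} {v v' v₂ : ℤ}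

/-- The members that meet `Y` are merged with `Y` one after the other; the meets stay inside
`Y`, the join is the new member `Z`. -/
theorem absorb (hp : IsBisupermodular p) (h : HasPacking p S U v) (T : Finset Λ)
    (hY : Y.Nonempty) :
    HasPacking p S (U \ Y) v ∨ ∃ T' Z w, T' ⊆ S ∩ T ∧ Y ⊆ Z ∧ Z ⊆ U ∪ Y ∧
      HasPacking p (S ∪ T) (U ∩ Y) w ∧ HasPacking p S (U \ Z) (v + p T Y - w - p T' Z) := by
  induction h with
  | nil hv => exact Or.inl (nil hv)
  | @cons U v T₁ X hT₁ hX hXU _ ih =>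
    rcases ih with h₁ | ⟨T', Z, w, hT', hYZ, hZ, h₁, h₂⟩
    · rcases (X ∩ Y).eq_empty_or_nonempty with hXY | hXY
      · have := Finset.disjoint_left.1 (Finset.disjoint_iff_inter_eq_empty.2 hXY)
        exact Or.inl (cons hT₁ hX (by grind) (h₁.mono subset_rfl (by grind)))
      · exact Or.inr ⟨T₁ ∩ T, X ∪ Y, p (T₁ ∪ T) (X ∩ Y), by grind, by grind, by grind,
          single (by grind) hXY (by grind),
          (h₁.mono subset_rfl (by grind)).of_le (by linarith [hp T₁ T X Y hXY])⟩
    · rcases (X ∩ Z).eq_empty_or_nonempty with hXZ | hXZ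
      · have := Finset.disjoint_left.1 (Finset.disjoint_iff_inter_eq_empty.2 hXZ)
        exact Or.inr ⟨T', Z, w, hT', hYZ, by grind, h₁.mono subset_rfl (by grind),
          cons hT₁ hX (by grind) ((h₂.mono subset_rfl (by grind)).of_le (by linarith))⟩
      · have hXZY : X ∩ Z = X ∩ Y := by grind
        have hle := hp T₁ T' X Z hXZ
        rw [hXZY] at hle hXZ
        exact Or.inr ⟨T₁ ∩ T', X ∪ Z, p (T₁ ∪ T') (X ∩ Y) + w, by grind, by grind, by grind,
          cons (T := T₁ ∪ T') (by grind) hXZ (by grind)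
            ((h₁.mono subset_rfl (by grind)).of_le (by linarith)),
          (h₂.mono subset_rfl (by grind)).of_le (by linarith)⟩

theorem absorb_of_subset (hp : IsBisupermodular p) (h : HasPacking p S U v) (hT : T ⊆ S)
    (hY : Y.Nonempty) :
    ∃ T' Z w, T' ⊆ T ∧ Y ⊆ Z ∧ Z ⊆ U ∪ Y ∧ HasPacking p S (U ∩ Y) w ∧
      HasPacking p S (U \ Z) (v + p T Y - w - p T' Z) := by
  rcases h.absorb hp T hY with h₁ | ⟨T', Z, w, hT', hYZ, hZ, h₁, h₂⟩
  · exact ⟨T, Y, 0, subset_rfl, subset_rfl, Finset.subset_union_right, nil le_rfl,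
      h₁.of_le (by linarith)⟩
  · exact ⟨T', Z, w, by grind, hYZ, hZ, h₁.mono (by grind) subset_rfl, h₂⟩

theorem uncross_member (hp : IsBisupermodular p) (h : HasPacking p S U v)
    (h₂ : HasPacking p (S ∩ S') U₂ v₂) (hd : Disjoint U U₂) (hT : T ⊆ S') (hY : Y.Nonempty) :
    ∃ U₃ U₄ w w₃, Disjoint U₃ U₄ ∧ U₃ ⊆ U \ Y ∧ U₄ ⊆ U ∪ U₂ ∪ Y ∧ HasPacking p (S ∪ S') Y w ∧
      HasPacking p S U₃ w₃ ∧ HasPacking p (S ∩ S') U₄ (v + v₂ + p T Y - w - w₃) := by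
  simp only [Finset.disjoint_left] at hd ⊢
  rcases h.absorb hp T hY with h₁ | ⟨T', Z, w, hT', hYZ, hZ, h₁, h₃⟩
  · rcases h₂.absorb hp T hY with h₄ | ⟨T', Z, w, hT', hYZ, hZ, h₃, h₄⟩
    · exact ⟨U \ Y, U₂ \ Y, p T Y, v, by grind, subset_rfl, by grind,
        single (by grind) hY subset_rfl, h₁, h₄.of_le (by linarith)⟩
    · exact ⟨U \ Y, U₂ ∪ Z, w, v, by grind, subset_rfl, by grind, h₃.mono (by grind) (by grind),
        h₁, (h₄.of_le (by linarith)).union_of_sdiff (by grind) (hY.mono hYZ)⟩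
  · obtain ⟨T'', Z', w', hT'', hZZ', hZ', h₁', h₄⟩ :=
      h₂.absorb_of_subset hp (T := T') (by grind) (hY.mono hYZ)
    refine ⟨U \ Z, U₂ ∪ Z', w + w', _, by grind, by grind, by grind, ?_, h₃,
      (h₄.of_le (by linarith)).union_of_sdiff (by grind) (hY.mono (hYZ.trans hZZ'))⟩
    refine ((h₁.mono (by grind) subset_rfl).add (h₁'.mono (by grind) subset_rfl)
      (Finset.disjoint_left.2 (by grind))).mono subset_rfl (by grind)

theorem uncross (hp : IsBisupermodular p) (h : HasPacking p S U v)
    (h₂ : HasPacking p (S ∩ S') U₂ v₂) (hd : Disjoint U U₂) (h' : HasPacking p S' U' v') :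
    ∃ w, HasPacking p (S ∪ S') (U ∪ U') w ∧
      HasPacking p (S ∩ S') (U ∪ U₂ ∪ U') (v + v₂ + v' - w) := by
  induction h' generalizing U U₂ v v₂ with
  | nil hv =>
    exact ⟨v, h.mono (by grind) (by grind),
      (h₂.mono subset_rfl (by grind)).of_le (by linarith)⟩
  | @cons U' v' T Y hT hY hYU _ ih =>
    obtain ⟨U₃, U₄, w, w₃, hd₃, h₃, h₄, hw, hw₃, hw₄⟩ := h.uncross_member hp h₂ hd hT hY
    obtain ⟨w', hw', hw''⟩ := ih hw₃ hw₄ hd₃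
    exact ⟨w + w', (hw.add hw' (Finset.disjoint_left.2 (by grind))).mono subset_rfl (by grind),
      (hw''.mono subset_rfl (by grind)).of_le (by linarith)⟩

theorem uncross_pair (hp : IsBisupermodular p) (h : HasPacking p S U v)
    (h' : HasPacking p S' U' v') :
    ∃ w, HasPacking p (S ∪ S') (U ∪ U') w ∧ HasPacking p (S ∩ S') (U ∪ U') (v + v' - w) := by
  simpa using h.uncross hp (nil le_rfl) (Finset.disjoint_empty_right U) h'

end HasPacking

/-- The function `p` lowered by one on the pairs `(T, X)` with `u ∈ X` that do not satisfy
`T ⊆ T₀` and `Y₀ ⊆ X`. -/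
def penalized (p : Finset Λ → Finset V → ℤ) (u : V) (T₀ : Finset Λ) (Y₀ : Finset V)
    (T : Finset Λ) (X : Finset V) : ℤ :=
  p T X - if u ∈ X ∧ ¬ (T ⊆ T₀ ∧ Y₀ ⊆ X) then 1 else 0

theorem penalized_le (p : Finset Λ → Finset V → ℤ) (u : V) (T₀ : Finset Λ) (Y₀ : Finset V)
    (T : Finset Λ) (X : Finset V) : penalized p u T₀ Y₀ T X ≤ p T X := by
  rw [penalized]
  split_ifs <;> linarith

theorem penalized_of_notMem (p : Finset Λ → Finset V → ℤ) {u : V} (T₀ : Finset Λ)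
    (Y₀ : Finset V) (T : Finset Λ) {X : Finset V} (hu : u ∉ X) :
    penalized p u T₀ Y₀ T X = p T X := by
  simp [penalized, hu]

theorem penalized_of_subset (p : Finset Λ → Finset V → ℤ) (u : V) {T₀ T : Finset Λ}
    {Y₀ X : Finset V} (hT : T ⊆ T₀) (hX : Y₀ ⊆ X) : penalized p u T₀ Y₀ T X = p T X := by
  simp [penalized, hT, hX]

theorem IsBisupermodular.penalized {p : Finset Λ → Finset V → ℤ} (hp : IsBisupermodular p)
    (u : V) (T₀ : Finset Λ) (Y₀ : Finset V) : IsBisupermodular (penalized p u T₀ Y₀) := by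
  intro S T X Y h
  have := hp S T X Y h
  have hu : u ∈ X ∩ Y ↔ u ∈ X ∧ u ∈ Y := Finset.mem_inter
  have hu' : u ∈ X ∪ Y ↔ u ∈ X ∨ u ∈ Y := Finset.mem_union
  have hT : S ∪ T ⊆ T₀ ↔ S ⊆ T₀ ∧ T ⊆ T₀ := Finset.union_subset_iff
  have hY : Y₀ ⊆ X ∩ Y ↔ Y₀ ⊆ X ∧ Y₀ ⊆ Y := Finset.subset_inter_iff
  have hS : S ⊆ T₀ ∨ T ⊆ T₀ → S ∩ T ⊆ T₀ :=
    Or.rec Finset.inter_subset_left.trans Finset.inter_subset_right.trans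
  have hX : Y₀ ⊆ X ∨ Y₀ ⊆ Y → Y₀ ⊆ X ∪ Y :=
    Or.rec (·.trans Finset.subset_union_left) (·.trans Finset.subset_union_right)
  simp only [_root_.penalized, hu, hu', hT, hY]
  grind

end Uncrossing

section Tight

variable {Λ V : Type*} [DecidableEq V]

/-- A packing inside `U` with labels in `S` attains the bound `a(S)`. -/
def IsTight (p : Finset Λ → Finset V → ℤ) (U : Finset V) (a : Λ → ℤ) (S : Finset Λ) : Prop :=
  HasPacking p S U (∑ α ∈ S, a α)

/-- A packing inside `U` with labels in `S` attains the bound `a(S)` and has the member `X`, which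
contains `u` and has the label `T`. -/
structure IsTightAt (p : Finset Λ → Finset V → ℤ) (U : Finset V) (a : Λ → ℤ) (u : V)
    (S T : Finset Λ) (X : Finset V) : Prop where
  label_subset : T ⊆ S
  subset : X ⊆ U
  mem : u ∈ X
  hasPacking : HasPacking p S (U \ X) (∑ α ∈ S, a α - p T X)

/-- Some tight packing has no member through `u` whose label contains `α`, so that
lowering `a α` and all values `p T X` with `α ∈ T` and `u ∈ X` by one makes `a` too small for it. -/
def IsBlocked (p : Finset Λ → Finset V → ℤ) (U : Finset V) (a : Λ → ℤ) (u : V) (α : Λ) : Prop :=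
  (∃ S, IsTight p (U.erase u) a S ∧ α ∈ S) ∨ ∃ S T X, IsTightAt p U a u S T X ∧ α ∈ S ∧ α ∉ T

variable {p : Finset Λ → Finset V → ℤ} {U : Finset V} {a : Λ → ℤ} {u : V}
  {R S T S' T' : Finset Λ} {X X' : Finset V}

theorem IsTightAt.nonempty (h : IsTightAt p U a u S T X) : X.Nonempty := ⟨u, h.mem⟩

variable [DecidableEq Λ]

theorem IsTight.union (hp : IsBisupermodular p) (ha : DominatesPackings p U a)
    (h : IsTight p U a S) (h' : IsTight p U a S') : IsTight p U a (S ∪ S') := by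
  obtain ⟨w, hw, hw'⟩ := h.uncross_pair hp h'
  rw [Finset.union_self] at hw hw'
  exact hw.of_le (by linarith [ha _ _ hw', Finset.sum_union_inter (s₁ := S) (s₂ := S') (f := a)])

theorem exists_greatest_isTight [Finite Λ] (hp : IsBisupermodular p)
    (ha : DominatesPackings p U a) : ∃ R, IsGreatest {S | IsTight p U a S} R := by
  obtain ⟨R, hR⟩ := (Set.toFinite {S | IsTight p U a S}).exists_maximal ⟨∅, .nil le_rfl⟩
  exact ⟨R, hR.prop, fun S hS => Finset.subset_union_right.trans
    (hR.le_of_ge (hR.prop.union hp ha hS) Finset.subset_union_left)⟩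

/-- The penalty makes a packing on the meet side worthless unless its member through `u` contains
`X ∪ X'` and has a label inside `T ∩ T'`. -/
theorem IsTightAt.uncross (hp : IsBisupermodular p) (h : IsTightAt p U a u S T X)
    (h' : IsTightAt p U a u S' T' X') :
    ∃ w, HasPacking p (S ∪ S') (U \ (X ∩ X')) w ∧
      HasPacking (penalized p u (T ∩ T') (X ∪ X')) (S ∩ S') U
        (∑ α ∈ S, a α + ∑ α ∈ S', a α - p (T ∪ T') (X ∩ X') - w) := by
  obtain ⟨hT, hX, hu, hS⟩ := h
  obtain ⟨hT', hX', hu', hS'⟩ := h'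
  set q := penalized p u (T ∩ T') (X ∪ X')
  have hq : IsBisupermodular q := hp.penalized u _ _
  have eq_of_notMem : ∀ {R U'}, u ∉ U' → ∀ Y ⊆ U', q R Y = p R Y := fun hU' Y hY =>
    penalized_of_notMem p _ _ _ fun h => hU' (hY h)
  have lift : ∀ {R U' w}, u ∉ U' → HasPacking q R U' w → HasPacking p R U' w :=
    fun hU' hw => hw.of_value_le fun _ Y hY => (eq_of_notMem hU' Y hY).le
  have lower : ∀ {R U' w}, u ∉ U' → HasPacking p R U' w → HasPacking q R U' w :=
    fun hU' hw => hw.of_value_le fun _ Y hY => (eq_of_notMem hU' Y hY).ge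
  have hne : (X ∪ X').Nonempty := ⟨u, by grind⟩
  obtain ⟨T₁, Z, w₁, hT₁, hXZ, hZ, hw₁, hZw⟩ :=
    (lower (by grind) hS).absorb_of_subset hq (T := T ∩ T') (Y := X ∪ X') (by grind) hne
  obtain ⟨w₂, hw₂, hw₃⟩ := HasPacking.uncross hq (S' := S') (U := U \ Z) (U₂ := Z)
    (hZw.mono subset_rfl (by grind)) (.single (T := T₁) (by grind) (hne.mono hXZ) subset_rfl)
    Finset.sdiff_disjoint (lower (by grind) hS')
  have hq₀ : q (T ∩ T') (X ∪ X') = p (T ∩ T') (X ∪ X') :=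
    penalized_of_subset p u subset_rfl subset_rfl
  have hpq := hp T T' X X' ⟨u, by grind⟩
  refine ⟨w₁ + w₂, ?_, (hw₃.mono subset_rfl (by grind)).of_le (by linarith)⟩
  exact ((lift (by grind) (hw₁.mono (by grind) subset_rfl)).add (lift (by grind) hw₂)
    (Finset.disjoint_left.2 (by grind))).mono subset_rfl (by grind)

theorem IsTightAt.join (hp : IsBisupermodular p) (ha : DominatesPackings p U a)
    (h : IsTightAt p U a u S T X) (h' : IsTightAt p U a u S' T' X') :
    IsTightAt p U a u (S ∪ S') (T ∪ T') (X ∩ X') := by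
  obtain ⟨w, hw, hw'⟩ := h.uncross hp h'
  have hmeet := ha _ _ (hw'.of_value_le fun _ _ _ => penalized_le ..)
  have hsum := Finset.sum_union_inter (s₁ := S) (s₂ := S') (f := a)
  exact ⟨Finset.union_subset_union h.label_subset h'.label_subset,
    Finset.inter_subset_left.trans h.subset, Finset.mem_inter.2 ⟨h.mem, h'.mem⟩,
    hw.of_le (by linarith)⟩

theorem IsTightAt.exists_meet (hp : IsBisupermodular p) (ha : DominatesPackings p U a)
    (h : IsTightAt p U a u S T X) (h' : IsTightAt p U a u S' T' X')
    (havoid : ¬ IsTight p (U.erase u) a (S ∩ S')) :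
    ∃ T₀ Z, T₀ ⊆ T ∩ T' ∧ X ∪ X' ⊆ Z ∧ IsTightAt p U a u (S ∩ S') T₀ Z := by
  obtain ⟨w, hw, hw'⟩ := h.uncross hp h'
  have hjoin := ha.value_le (Finset.union_subset_union h.label_subset h'.label_subset)
    ⟨u, Finset.mem_inter.2 ⟨h.mem, h'.mem⟩⟩ (Finset.inter_subset_left.trans h.subset) hw
  have hsum := Finset.sum_union_inter (s₁ := S) (s₂ := S') (f := a)
  rcases hw'.split_at u with h₁ | ⟨T₀, Z, hT₀, hZ, huZ, h₁⟩
  · exact absurd ((h₁.of_value_le fun _ _ _ => penalized_le ..).of_le (by linarith)) havoid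
  have h₂ : HasPacking p (S ∩ S') (U \ Z) _ := h₁.of_value_le fun _ _ _ => penalized_le ..
  by_cases hTZ : T₀ ⊆ T ∩ T' ∧ X ∪ X' ⊆ Z
  · rw [penalized_of_subset p u hTZ.1 hTZ.2] at h₂
    exact ⟨T₀, Z, hTZ.1, hTZ.2, hT₀, hZ, huZ, h₂.of_le (by linarith)⟩
  · have hlt : penalized p u (T ∩ T') (X ∪ X') T₀ Z = p T₀ Z - 1 := by
      simp only [penalized, huZ, hTZ, not_false_eq_true, and_self, if_true]
    linarith [ha.value_le hT₀ ⟨u, huZ⟩ hZ h₂]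

theorem IsTightAt.union_isTight (hp : IsBisupermodular p) (ha : DominatesPackings p U a)
    (h : IsTightAt p U a u S T X) (hR : IsTight p (U.erase u) a R) :
    IsTight p (U.erase u) a (R ∪ S) ∨
      IsTightAt p U a u (R ∪ S) T X ∧ IsTight p (U \ X) a R := by
  obtain ⟨hT, hX, hu, hS⟩ := h
  have hsum := Finset.sum_union_inter (s₁ := R) (s₂ := S) (f := a)
  rcases hR.absorb hp T ⟨u, hu⟩ with h₁ | ⟨T', Z, w, hT', hXZ, hZ, h₁, h₂⟩
  · have hRX : IsTight p (U \ X) a R := h₁.mono subset_rfl (by grind)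
    obtain ⟨w, hw, hw'⟩ := hRX.uncross_pair hp hS
    rw [Finset.union_self] at hw hw'
    have hmeet := ha.mono Finset.sdiff_subset _ _ hw'
    exact Or.inr ⟨⟨by grind, hX, hu, hw.of_le (by linarith)⟩, hRX⟩
  · obtain ⟨w', hw, hw'⟩ := h₂.uncross hp
      (.single (T := T') (X := Z) (by grind) ⟨u, hXZ hu⟩ subset_rfl)
      (Finset.disjoint_left.2 (by grind)) hS
    have hmeet := ha _ _ (hw'.mono subset_rfl (by grind))
    have hwhole := (h₁.mono (S' := R ∪ S) (by grind) subset_rfl).add hw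
      (Finset.disjoint_left.2 (by grind))
    exact Or.inl ((hwhole.mono subset_rfl (by grind)).of_le (by linarith))

theorem IsBlocked.exists_isTightAt (hp : IsBisupermodular p) (ha : DominatesPackings p U a)
    (hR : IsGreatest {S | IsTight p (U.erase u) a S} R) {α : Λ} (hα : IsBlocked p U a u α)
    (hαR : α ∉ R) : ∃ S T X, IsTightAt p U a u S T X ∧ R ⊆ S ∧ α ∈ S ∧ α ∉ T := by
  rcases hα with ⟨S, hS, hαS⟩ | ⟨S, T, X, hS, hαS, hαT⟩
  · exact absurd (hR.2 hS hαS) hαR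
  rcases hS.union_isTight hp ha hR.1 with h | ⟨h, -⟩
  · exact absurd (hR.2 h (Finset.mem_union_right _ hαS)) hαR
  · exact ⟨R ∪ S, T, X, h, Finset.subset_union_left, Finset.mem_union_right _ hαS, hαT⟩

theorem IsTightAt.exists_le_of_isBlocked (hp : IsBisupermodular p) (ha : DominatesPackings p U a)
    (hR : IsGreatest {S | IsTight p (U.erase u) a S} R) (h : IsTightAt p U a u S T X)
    (hRS : R ⊆ S) {α : Λ} (hα : IsBlocked p U a u α) (hαT : α ∈ T) (hαR : α ∉ R) :
    ∃ S' T' X', IsTightAt p U a u S' T' X' ∧ R ⊆ S' ∧ S' ⊆ S ∧ T' ⊆ T ∧ α ∈ S' ∧ α ∉ T' := by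
  obtain ⟨S', T', X', h', hRS', hαS', hαT'⟩ := hα.exists_isTightAt hp ha hR hαR
  have hαS := h.label_subset hαT
  obtain ⟨T₀, Z, hT₀, -, h₀⟩ := h'.exists_meet hp ha h fun h => hαR (hR.2 h (by grind))
  exact ⟨S' ∩ S, T₀, Z, h₀, by grind, by grind, by grind, by grind, by grind⟩

theorem IsTightAt.exists_lower_cover [Finite Λ] (hp : IsBisupermodular p)
    (ha : DominatesPackings p U a) (hR : IsGreatest {S | IsTight p (U.erase u) a S} R)
    (hblocked : ∀ α, IsBlocked p U a u α) (h : IsTightAt p U a u S T X) (hRS : R ⊆ S)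
    (hTR : ¬ T ⊆ R) :
    ∃ S' T' X', IsTightAt p U a u S' T' X' ∧ R ⊂ S' ∧ (S', T') < (S, T) ∧ T ⊆ S' := by
  obtain ⟨α, hαT, hαR⟩ := Finset.not_subset.1 hTR
  obtain ⟨S₁, T₁, X₁, h₁, hRS₁, hS₁, hT₁, hαS₁, hαT₁⟩ :=
    h.exists_le_of_isBlocked hp ha hR hRS (hblocked α) hαT hαR
  have lt_of : ∀ {S' T' : Finset Λ} {β : Λ}, S' ⊆ S → T' ⊆ T → β ∈ T → β ∉ T' →
      (S', T') < (S, T) := fun hS' hT' hβ hβ' =>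
    Prod.mk_lt_mk.2 (Or.inr ⟨hS', hT', fun hle => hβ' (hle hβ)⟩)
  obtain ⟨⟨S', T'⟩, hmax⟩ := (Set.toFinite {P : Finset Λ × Finset Λ | R ⊂ P.1 ∧ P < (S, T) ∧
    ∃ X', IsTightAt p U a u P.1 P.2 X'}).exists_maximal
    ⟨(S₁, T₁), ⟨hRS₁, fun hle => hαR (hle hαS₁)⟩, lt_of hS₁ hT₁ hαT hαT₁, X₁, h₁⟩
  obtain ⟨hRS', hlt, X', h'⟩ := hmax.prop
  refine ⟨S', T', X', h', hRS', hlt, fun β hβT => ?_⟩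
  by_contra hβS'
  obtain ⟨S₃, T₃, X₃, h₃, -, hS₃, hT₃, hβS₃, hβT₃⟩ :=
    h.exists_le_of_isBlocked hp ha hR hRS (hblocked β) hβT fun hβ => hβS' (hRS'.1 hβ)
  have hβT' : β ∉ T' := fun hβ => hβS' (h'.label_subset hβ)
  have hle : (S' ∪ S₃, T' ∪ T₃) ≤ (S', T') := hmax.le_of_ge
    ⟨hRS'.trans_subset Finset.subset_union_left,
      lt_of (Finset.union_subset hlt.le.1 hS₃) (Finset.union_subset hlt.le.2 hT₃) hβT
        (by simp [hβT', hβT₃]), _, h'.join hp ha h₃⟩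
    ⟨Finset.subset_union_left, Finset.subset_union_left⟩
  exact hβS' (hle.1 (Finset.mem_union_right _ hβS₃))

theorem IsTightAt.value_nonpos [Finite Λ] (hp : IsBisupermodular p)
    (ha : DominatesPackings p U a) (hR : IsGreatest {S | IsTight p (U.erase u) a S} R)
    (hblocked : ∀ α, IsBlocked p U a u α) (h : IsTightAt p U a u S T X) (hRS : R ⊂ S) :
    p T X ≤ 0 := by
  induction hP : (S, T) using WellFoundedLT.induction generalizing S T X with
  | _ P ih =>
  subst hP
  have not_tight : ∀ {S'}, R ⊂ S' → ¬ IsTight p (U.erase u) a S' :=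
    fun hS' hS'' => hS'.2 (hR.2 hS'')
  rcases h.union_isTight hp ha hR.1 with h₁ | ⟨-, hRX⟩
  · exact absurd ((Finset.union_eq_right.2 hRS.1) ▸ h₁) (not_tight hRS)
  by_cases hTR : T ⊆ R
  · linarith [ha.value_le hTR h.nonempty h.subset hRX]
  obtain ⟨S', T', X', h', hRS', hlt, hTS'⟩ := h.exists_lower_cover hp ha hR hblocked hRS.1 hTR
  have hS' : S' ∩ S = S' := Finset.inter_eq_left.2 hlt.le.1
  obtain ⟨T₀, Z, hT₀, hZ, h₀⟩ := h'.exists_meet hp ha h (by rw [hS']; exact not_tight hRS')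
  rw [hS'] at h₀
  have hle₀ : p T₀ Z ≤ 0 := ih _ (lt_of_le_of_lt
    (Prod.mk_le_mk.2 ⟨le_rfl, hT₀.trans Finset.inter_subset_left⟩) hlt) h₀ hRS' rfl
  linarith [ha.value_le hTS' h.nonempty h.subset (h₀.hasPacking.mono subset_rfl
    (Finset.sdiff_subset_sdiff subset_rfl (Finset.subset_union_right.trans hZ)))]

theorem exists_not_isBlocked [Fintype Λ] (hp : IsBisupermodular p) (ha : DominatesPackings p U a)
    {b : V → ℤ} (hb : ∀ v ∈ U, b v ≤ p Finset.univ {v}) (hab : ∑ α, a α = ∑ v ∈ U, b v)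
    (hu : u ∈ U) (hbu : 0 < b u) : ∃ α, ¬ IsBlocked p U a u α := by
  by_contra! hblocked
  obtain ⟨R, hR⟩ := exists_greatest_isTight hp (ha.mono (Finset.erase_subset u U))
  have hpu := hb u hu
  have huU : {u} ⊆ U := Finset.singleton_subset_iff.2 hu
  have hRuniv : R ⊂ Finset.univ := by
    refine Finset.ssubset_univ_iff.2 fun h => ?_
    have hpack : IsTight p (U \ {u}) a Finset.univ := by
      simpa [h, Finset.sdiff_singleton_eq_erase] using hR.1
    linarith [ha.value_le subset_rfl ⟨u, by simp⟩ huU hpack]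
  have htight : IsTightAt p U a u Finset.univ Finset.univ {u} := by
    refine ⟨subset_rfl, huU, by simp, ?_⟩
    rw [Finset.sdiff_singleton_eq_erase]
    refine (HasPacking.singletons fun v hv => hb v (Finset.mem_of_mem_erase hv)).of_le ?_
    linarith [Finset.add_sum_erase U b hu]
  linarith [htight.value_nonpos hp ha hR hblocked hRuniv]

end Tight

section Covering

variable {Λ V : Type*} [DecidableEq Λ] [DecidableEq V]

/-- The sum of the entries of `m` in the rows `S` and the columns `X`. -/
def blockSum (m : Matrix Λ V ℕ) (S : Finset Λ) (X : Finset V) : ℕ := ∑ z ∈ S ×ˢ X, m z.1 z.2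

theorem exists_eq_add_single {m : Matrix Λ V ℕ} {α : Λ} {u : V} (hm : m α u ≠ 0) :
    ∃ m', m = m' + Matrix.single α u 1 := by
  refine ⟨m - Matrix.single α u 1, ?_⟩
  ext β v
  simp only [Matrix.add_apply, Matrix.sub_apply, Matrix.single_apply]
  grind

section BlockSum

variable (m m' : Matrix Λ V ℕ) (S T : Finset Λ) (X Y : Finset V)

omit [DecidableEq Λ] [DecidableEq V] in
theorem blockSum_add : blockSum (m + m') S X = blockSum m S X + blockSum m' S X :=
  Finset.sum_add_distrib

theorem blockSum_single (α : Λ) (u : V) :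
    blockSum (Matrix.single α u 1) S X = if α ∈ S ∧ u ∈ X then 1 else 0 := by
  simp [blockSum, Finset.sum_product, Matrix.single_apply, ite_and]

omit [DecidableEq Λ] [DecidableEq V] in
theorem blockSum_zero : blockSum (0 : Matrix Λ V ℕ) S X = 0 := Finset.sum_const_zero

variable {S T} in
omit [DecidableEq Λ] [DecidableEq V] in
theorem blockSum_mono (h : S ⊆ T) : blockSum m S X ≤ blockSum m T X :=
  Finset.sum_le_sum_of_subset (Finset.product_subset_product_left h)

theorem blockSum_union_inter_le :
    blockSum m (S ∪ T) (X ∩ Y) + blockSum m (S ∩ T) (X ∪ Y) ≤ blockSum m S X + blockSum m T Y := by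
  have hunion : (S ∪ T) ×ˢ (X ∩ Y) ∪ (S ∩ T) ×ˢ (X ∪ Y) ⊆ S ×ˢ X ∪ T ×ˢ Y := by
    intro z; simp only [Finset.mem_union, Finset.mem_product, Finset.mem_inter]; tauto
  have hinter : (S ∪ T) ×ˢ (X ∩ Y) ∩ (S ∩ T) ×ˢ (X ∪ Y) = S ×ˢ X ∩ T ×ˢ Y := by
    ext z; simp only [Finset.mem_union, Finset.mem_product, Finset.mem_inter]; tauto
  simp only [blockSum]
  rw [← Finset.sum_union_inter, ← Finset.sum_union_inter (s₁ := S ×ˢ X), hinter]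
  gcongr

theorem IsBisupermodular.sub_blockSum {p : Finset Λ → Finset V → ℤ} (hp : IsBisupermodular p)
    (m : Matrix Λ V ℕ) : IsBisupermodular fun S X => p S X - blockSum m S X := by
  intro S T X Y h
  have hm := blockSum_union_inter_le m S T X Y
  have := hp S T X Y h
  lia

end BlockSum

theorem DominatesPackings.sub_single {p : Finset Λ → Finset V → ℤ} {U : Finset V} {a : Λ → ℤ}
    (ha : DominatesPackings p U a) {α : Λ} {u : V} (hα : ¬ IsBlocked p U a u α) :
    DominatesPackings (fun S X => p S X - blockSum (Matrix.single α u 1) S X) U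
      (a - Pi.single α 1) := by
  intro S v hv
  simp only [Pi.sub_apply, Finset.sum_sub_distrib, Finset.sum_pi_single']
  simp only [blockSum_single] at hv
  have hle : ∀ T X, p T X - ((if α ∈ T ∧ u ∈ X then 1 else 0 : ℕ) : ℤ) ≤ p T X := by lia
  by_cases hαS : α ∈ S
  swap
  · simpa [hαS] using ha _ _ (hv.of_value_le fun T X _ => hle T X)
  rw [if_pos hαS]
  rcases hv.split_at u with h₁ | ⟨T, X, hT, hX, huX, h₁⟩
  · have hpack := h₁.of_value_le fun T X _ => hle T X
    by_contra! hlt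
    exact hα (Or.inl ⟨S, hpack.of_le (by linarith), hαS⟩)
  · have hpack := h₁.of_value_le fun T X _ => hle T X
    have hdom := ha.value_le hT ⟨u, huX⟩ hX hpack
    by_cases hαT : α ∈ T
    · simp only [hαT, huX, and_self, if_true] at hdom
      lia
    · simp only [hαT, false_and, if_false] at hdom hpack
      by_contra! hlt
      exact hα (Or.inr ⟨S, T, X, ⟨hT, hX, huX, hpack.of_le (by lia)⟩, hαS, hαT⟩)

variable [Fintype Λ]

/-- Units are placed one at a time in the column of some `u` with `0 < b u`, always in an unblocked
row. -/
theorem exists_covering_matrix {U : Finset V} {p : Finset Λ → Finset V → ℤ}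
    (hp : IsBisupermodular p) {a : Λ → ℤ} {b : V → ℤ} (ha : DominatesPackings p U a)
    (hb₀ : ∀ v ∈ U, 0 ≤ b v) (hb : ∀ v ∈ U, b v ≤ p Finset.univ {v})
    (hab : ∑ α, a α = ∑ v ∈ U, b v) :
    ∃ m : Matrix Λ V ℕ, (∀ α, (blockSum m {α} U : ℤ) = a α) ∧
      (∀ v ∈ U, (blockSum m Finset.univ {v} : ℤ) = b v) ∧
      ∀ S, ∀ X ⊆ U, X.Nonempty → p S X ≤ blockSum m S X := by
  obtain ⟨n, hn⟩ := Int.eq_ofNat_of_zero_le (Finset.sum_nonneg hb₀)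
  induction n generalizing p a b with
  | zero =>
    have ha₀ : ∀ α, 0 ≤ a α := fun α => by simpa using ha {α} 0 (.nil le_rfl)
    have ha_eq : ∀ α, a α = 0 := fun α =>
      (Finset.sum_eq_zero_iff_of_nonneg fun α _ => ha₀ α).1 (hab.trans hn) α (Finset.mem_univ α)
    have hb_eq := (Finset.sum_eq_zero_iff_of_nonneg hb₀).1 hn
    refine ⟨0, fun α => by simp [blockSum_zero, ha_eq],
      fun v hv => by simp [blockSum_zero, hb_eq v hv], fun S X hX hne => ?_⟩
    simpa [blockSum_zero, ha_eq] using ha S _ (.single subset_rfl hne hX)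
  | succ n ih =>
    obtain ⟨u, hu, hbu⟩ : ∃ u ∈ U, 0 < b u := by
      by_contra! h
      have := Finset.sum_nonpos h
      lia
    obtain ⟨α, hα⟩ := exists_not_isBlocked hp ha hb hab hu hbu
    have hsum_b : ∑ v ∈ U, (b - Pi.single u 1 : V → ℤ) v = ∑ v ∈ U, b v - 1 := by
      simp [Finset.sum_pi_single', hu]
    have hb₀' : ∀ v ∈ U, 0 ≤ (b - Pi.single u 1 : V → ℤ) v := fun v hv => by
      by_cases h : v = u
      · subst h; simpa using Int.le_sub_one_of_lt hbu
      · simpa [h] using hb₀ v hv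
    have hb' : ∀ v ∈ U, (b - Pi.single u 1 : V → ℤ) v ≤
        p Finset.univ {v} - blockSum (Matrix.single α u 1) Finset.univ {v} := fun v hv => by
      by_cases h : v = u
      · subst h; simp [blockSum_single, hb v hv]
      · simpa [h, Ne.symm h, blockSum_single] using hb v hv
    obtain ⟨m, hrow, hcol, hcov⟩ := ih (hp.sub_blockSum (Matrix.single α u 1)) (ha.sub_single hα)
      hb₀' hb' (by rw [hsum_b, ← hab]; simp [Finset.sum_pi_single']) (by rw [hsum_b, hn]; simp)
    refine ⟨m + Matrix.single α u 1, fun β => ?_, fun v hv => ?_, fun S X hX hne => ?_⟩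
    · rw [blockSum_add, Nat.cast_add, hrow β, blockSum_single]
      by_cases h : α = β
      · subst h; simp [hu]
      · simp [h, Ne.symm h]
    · rw [blockSum_add, Nat.cast_add, hcol v hv, blockSum_single]
      by_cases h : u = v
      · subst h; simp
      · simp [h, Ne.symm h]
    · rw [blockSum_add, Nat.cast_add]
      linarith [hcov S X hX hne]

theorem exists_decreasable {p : Finset Λ → Finset V → ℤ} (hp : IsBisupermodular p) {U : Finset V}
    {lo hi : Λ → ℤ} {N : ℤ} (hN : N < ∑ α, hi α)
    (hhi : DominatesPackings p U hi)
    (hlo : ∀ S v, HasPacking p S U v → v + ∑ α ∈ Sᶜ, lo α ≤ N) :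
    ∃ α, lo α < hi α ∧ ∀ S, IsTight p U hi S → α ∉ S := by
  obtain ⟨R, hR, hmax⟩ := exists_greatest_isTight hp hhi
  obtain ⟨α, hαR, hα⟩ : ∃ α ∈ Rᶜ, lo α < hi α := by
    by_contra! h
    linarith [hlo R _ hR, Finset.sum_add_sum_compl R hi, Finset.sum_le_sum h]
  exact ⟨α, hα, fun S hS hαS => Finset.mem_compl.1 hαR (hmax hS hαS)⟩

theorem exists_vector_in_box {p : Finset Λ → Finset V → ℤ} (hp : IsBisupermodular p)
    {U : Finset V} {lo hi : Λ → ℤ} (hle : lo ≤ hi) {N : ℤ} (hN : N ≤ ∑ α, hi α)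
    (hhi : DominatesPackings p U hi)
    (hlo : ∀ S v, HasPacking p S U v → v + ∑ α ∈ Sᶜ, lo α ≤ N) :
    ∃ a ∈ Set.Icc lo hi, ∑ α, a α = N ∧ DominatesPackings p U a := by
  obtain ⟨n, hn⟩ := Int.le.dest hN
  induction n generalizing hi with
  | zero => exact ⟨hi, ⟨hle, le_rfl⟩, by simpa using hn.symm, hhi⟩
  | succ n ih =>
    obtain ⟨α, hα, hαS⟩ := exists_decreasable hp (by lia) hhi hlo
    have hsum : ∑ β, (hi - Pi.single α 1 : Λ → ℤ) β = ∑ β, hi β - 1 := by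
      simp [Finset.sum_pi_single']
    have hle' : lo ≤ hi - Pi.single α 1 := fun β => by
      by_cases h : β = α
      · subst h; simpa using Int.le_sub_one_of_lt hα
      · simpa [h] using hle β
    have hdom' : DominatesPackings p U (hi - Pi.single α 1) := fun S v hv => by
      have hv' := hhi S v hv
      simp only [Pi.sub_apply, Finset.sum_sub_distrib, Finset.sum_pi_single']
      split_ifs with h
      · by_contra! hlt
        exact hαS S (hv.of_le (by linarith)) h
      · linarith
    obtain ⟨a, ha, hsum_a, hdom⟩ := ih hle' (by lia) hdom' (by lia)
    exact ⟨a, ⟨ha.1, ha.2.trans (sub_le_self _ (Pi.single_nonneg.2 zero_le_one))⟩, hsum_a, hdom⟩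

end Covering

namespace MultiDigraph

section Arborescence

variable {W A : Type*} {D : MultiDigraph W A}

theorem isWalk_append {r u : W} {p q : List A} :
    D.IsWalk r (p ++ q) u ↔ ∃ v, D.IsWalk r p v ∧ D.IsWalk v q u := by
  induction p generalizing r with
  | nil => simp [IsWalk]
  | cons a p ih => simp [IsWalk, ih, and_assoc]

theorem IsWalk.exists_entering {r u : W} {p : List A} (h : D.IsWalk r p u) {X : Set W}
    (hr : r ∉ X) (hu : u ∈ X) : ∃ a ∈ p, D.tail a ∉ X ∧ D.head a ∈ X := by
  induction p generalizing r with
  | nil => exact absurd (h ▸ hu) hr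
  | cons a p ih =>
    obtain ⟨rfl, h⟩ := h
    by_cases ha : D.head a ∈ X
    · exact ⟨a, by simp, hr, ha⟩
    · obtain ⟨b, hb, h'⟩ := ih h ha
      exact ⟨b, by simp [hb], h'⟩

namespace Sub

variable {F G : D.Sub} {r u : W} {p : List A} {e : A}

theorem IsSubOf.refl (F : D.Sub) : F.IsSubOf F := ⟨subset_rfl, subset_rfl⟩

theorem IsSubOf.trans {H : D.Sub} (hFG : F.IsSubOf G) (hGH : G.IsSubOf H) : F.IsSubOf H :=
  ⟨hFG.1.trans hGH.1, hFG.2.trans hGH.2⟩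

theorem IsPath.mono (hFG : F.IsSubOf G) (h : F.IsPath r p u) : G.IsPath r p u :=
  ⟨h.1, fun a ha => hFG.2 (h.2.1 a ha), h.2.2⟩

theorem IsPath.mem_verts (hr : r ∈ F.verts) (h : F.IsPath r p u) :
    ∀ v ∈ r :: p.map D.head, v ∈ F.verts := by
  intro v hv
  rcases List.mem_cons.1 hv with rfl | hv
  · exact hr
  · obtain ⟨a, ha, rfl⟩ := List.mem_map.1 hv
    exact F.head_mem a (h.2.1 a ha)

theorem natCard_edgeSet (h : Set.InjOn (fun a => s(D.tail a, D.head a)) F.arcs) :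
    Nat.card F.simpleGraph.edgeSet = F.arcs.card := by
  let ends : F.arcs → Sym2 F.verts := fun a =>
    s(⟨D.tail a, F.tail_mem a a.2⟩, ⟨D.head a, F.head_mem a a.2⟩)
  have hends : Function.Injective ends := fun a b hab =>
    Subtype.ext (h a.2 b.2 (by simpa [ends] using congrArg (Sym2.map Subtype.val) hab))
  have hrange : F.simpleGraph.edgeSet = Set.range ends := by
    ext e
    induction e using Sym2.inductionOn with
    | hf u v =>
      simp only [SimpleGraph.mem_edgeSet, Set.mem_range, Subtype.exists, ends, simpleGraph,
        Sym2.eq_iff, Subtype.ext_iff, exists_prop]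
  rw [hrange, Nat.card_range_of_injective hends, Nat.card_eq_fintype_card, Fintype.card_coe]

theorem isUnderlyingTree_iff : F.IsUnderlyingTree ↔
    (∀ a ∈ F.arcs, ∀ b ∈ F.arcs, s(D.tail a, D.head a) = s(D.tail b, D.head b) → a = b) ∧
      F.simpleGraph.Connected ∧ F.arcs.card + 1 = F.verts.card := by
  refine and_congr_right fun h => ?_
  rw [SimpleGraph.isTree_iff_connected_and_card, natCard_edgeSet fun a ha b hb => h a ha b hb,
    Nat.card_eq_fintype_card, Fintype.card_coe]

/-- A second path to the head of `e` would be a path of `F`. -/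
theorem IsArborescence.head_notMem (hF : F.IsArborescence r) (hG : G.IsArborescence r)
    (hFG : F.IsSubOf G) (he : e ∈ G.arcs) (he' : e ∉ F.arcs) (hr : D.tail e = r) :
    D.head e ∉ F.verts := by
  intro hu
  obtain ⟨p, hp, -⟩ := hF.2.2 _ hu
  have hsingle : G.IsPath r [e] (D.head e) :=
    ⟨⟨hr, rfl⟩, by simpa using he, by simpa using (hr ▸ D.tail_ne_head e)⟩
  have hpe : p = [e] := (hG.2.2 _ (hFG.1 hu)).unique (hp.mono hFG) hsingle
  exact he' (hp.2.1 e (by simp [hpe]))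

variable [DecidableEq W] [DecidableEq A]

/-- The subdigraph `F` together with an arc `e` whose tail is a vertex of `F`, and the head
of `e`. -/
def addArc (F : D.Sub) (e : A) (he : D.tail e ∈ F.verts) : D.Sub where
  verts := insert (D.head e) F.verts
  arcs := insert e F.arcs
  tail_mem := Finset.forall_mem_insert _ _ _ |>.2
    ⟨Finset.mem_insert_of_mem he, fun a ha => Finset.mem_insert_of_mem (F.tail_mem a ha)⟩
  head_mem := Finset.forall_mem_insert _ _ _ |>.2
    ⟨Finset.mem_insert_self _ _, fun a ha => Finset.mem_insert_of_mem (F.head_mem a ha)⟩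

theorem isSubOf_addArc (he : D.tail e ∈ F.verts) : F.IsSubOf (F.addArc e he) :=
  ⟨Finset.subset_insert _ _, Finset.subset_insert _ _⟩

theorem connected_addArc (h : F.simpleGraph.Connected) (he : D.tail e ∈ F.verts) :
    (F.addArc e he).simpleGraph.Connected := by
  let φ : F.simpleGraph →g (F.addArc e he).simpleGraph :=
    { toFun := fun v => ⟨v, Finset.mem_insert_of_mem v.2⟩
      map_rel' := fun ⟨a, ha, h⟩ => ⟨a, Finset.mem_insert_of_mem ha, h⟩ }
  rw [SimpleGraph.connected_iff_exists_forall_reachable]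
  refine ⟨⟨D.tail e, Finset.mem_insert_of_mem he⟩, fun v => ?_⟩
  rcases Finset.mem_insert.1 v.2 with hv | hv
  · exact SimpleGraph.Adj.reachable ⟨e, Finset.mem_insert_self _ _, Or.inl ⟨rfl, hv.symm⟩⟩
  · exact (h.preconnected ⟨D.tail e, he⟩ ⟨v, hv⟩).map φ

theorem IsUnderlyingTree.addArc (h : F.IsUnderlyingTree) (he : D.tail e ∈ F.verts)
    (he' : D.head e ∉ F.verts) : (F.addArc e he).IsUnderlyingTree := by
  rw [isUnderlyingTree_iff] at h ⊢
  obtain ⟨hparallel, hconn, hcard⟩ := h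
  have hnew : ∀ a ∈ F.arcs, s(D.tail a, D.head a) ≠ s(D.tail e, D.head e) := by
    intro a ha hae
    have : D.head e ∈ s(D.tail a, D.head a) := hae ▸ Sym2.mem_mk_right _ _
    rcases Sym2.mem_iff.1 this with h | h
    · exact he' (h ▸ F.tail_mem a ha)
    · exact he' (h ▸ F.head_mem a ha)
  refine ⟨fun a ha b hb hab => ?_, connected_addArc hconn he, ?_⟩
  · rcases Finset.mem_insert.1 ha with hae | ha' <;> rcases Finset.mem_insert.1 hb with hbe | hb'
    · rw [hae, hbe]
    · exact absurd (hae ▸ hab.symm) (hnew b hb')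
    · exact absurd (hbe ▸ hab) (hnew a ha')
    · exact hparallel a ha' b hb' hab
  · have he'' : e ∉ F.arcs := fun h => he' (F.head_mem e h)
    simp only [Sub.addArc]
    rw [Finset.card_insert_of_notMem he', Finset.card_insert_of_notMem he'', hcard]

theorem isPath_addArc_iff_of_mem (he : D.tail e ∈ F.verts) (he' : D.head e ∉ F.verts)
    (hu : u ∈ F.verts) : (F.addArc e he).IsPath r p u ↔ F.IsPath r p u := by
  refine ⟨fun h => ⟨h.1, fun a ha => ?_, h.2.2⟩, fun h => h.mono (isSubOf_addArc he)⟩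
  rcases Finset.mem_insert.1 (h.2.1 a ha) with rfl | h'
  · exfalso
    obtain ⟨p₁, p₂, rfl⟩ := List.append_of_mem ha
    obtain ⟨v, -, -, hw⟩ := isWalk_append.1 h.1
    cases p₂ with
    | nil => exact he' (hw ▸ hu)
    | cons b p₂ =>
      rcases Finset.mem_insert.1 (h.2.1 b (by simp)) with rfl | hb
      · exact D.tail_ne_head _ hw.1
      · exact he' (hw.1 ▸ F.tail_mem b hb)
  · exact h'

theorem IsPath.concat (he : D.tail e ∈ F.verts) (he' : D.head e ∉ F.verts) (hr : r ∈ F.verts)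
    (h : F.IsPath r p (D.tail e)) : (F.addArc e he).IsPath r (p ++ [e]) (D.head e) := by
  refine ⟨isWalk_append.2 ⟨_, h.1, rfl, rfl⟩, fun a ha => ?_, ?_⟩
  · exact Finset.mem_insert.2 ((List.mem_append.1 ha).symm.imp List.mem_singleton.1 (h.2.1 a))
  · rw [List.map_append, ← List.cons_append, List.nodup_append]
    refine ⟨h.2.2, List.nodup_singleton _, fun v hv w hw hvw => he' ?_⟩
    rw [← List.mem_singleton.1 hw, ← hvw]
    exact h.mem_verts hr v hv

theorem IsPath.exists_eq_concat (he : D.tail e ∈ F.verts) (he' : D.head e ∉ F.verts)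
    (hr : r ∈ F.verts) (h : (F.addArc e he).IsPath r p (D.head e)) :
    ∃ q, p = q ++ [e] ∧ F.IsPath r q (D.tail e) := by
  rcases List.eq_nil_or_concat p with rfl | ⟨q, a, rfl⟩
  · exact absurd (h.1 ▸ hr) he'
  rw [List.concat_eq_append] at h ⊢
  obtain ⟨v, hw, rfl, ha⟩ := isWalk_append.1 h.1
  obtain rfl : a = e := by
    rcases Finset.mem_insert.1 (h.2.1 a (by simp)) with h | h
    · exact h
    · exact absurd (ha ▸ F.head_mem a h) he'
  exact ⟨q, rfl, (isPath_addArc_iff_of_mem he he' he).1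
    ⟨hw, fun b hb => h.2.1 b (by simp [hb]), h.2.2.sublist (by simp)⟩⟩

theorem IsArborescence.addArc (h : F.IsArborescence r) (he : D.tail e ∈ F.verts)
    (he' : D.head e ∉ F.verts) : (F.addArc e he).IsArborescence r := by
  obtain ⟨hr, htree, hpath⟩ := h
  refine ⟨Finset.mem_insert_of_mem hr, htree.addArc he he', fun u hu => ?_⟩
  rcases Finset.mem_insert.1 hu with rfl | hu
  · obtain ⟨p, hp, hunique⟩ := hpath _ he
    refine ⟨p ++ [e], hp.concat he he' hr, fun q hq => ?_⟩
    obtain ⟨q', rfl, hq'⟩ := hq.exists_eq_concat he he' hr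
    exact congrArg (· ++ [e]) (hunique q' hq')
  · simpa only [isPath_addArc_iff_of_mem he he' hu] using hpath u hu

end Sub

end Arborescence

section Families

variable {W A : Type*} {D : MultiDigraph W A} {k : ℕ}

/-- The members of `F` are pairwise arc-disjoint `x`-arborescences. -/
structure IsArborescencePacking (F : Fin k → D.Sub) (x : W) : Prop where
  isArborescence : ∀ i, (F i).IsArborescence x
  arcDisjoint : ArcDisjoint F

/-- `F'` is a packing of spanning `x`-arborescences whose members contain those of `F`. -/
structure IsSpanningExtension (F F' : Fin k → D.Sub) (x : W) : Prop where
  isPacking : IsArborescencePacking F' x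
  isSpanning : ∀ i, (F' i).IsSpanning
  isSubOf : ∀ i, (F i).IsSubOf (F' i)

theorem mem_missing [DecidableEq W] {F : Fin k → D.Sub} {I : Finset (Fin k)} {X : Finset W}
    {i : Fin k} : i ∈ missing F I X ↔ i ∈ I ∧ Disjoint X (F i).verts := by
  simp [missing]

theorem mem_freeArcs [DecidableEq A] [Fintype A] {F : Fin k → D.Sub} {a : A} :
    a ∈ freeArcs F ↔ ∀ i, a ∉ (F i).arcs := by
  simp [freeArcs]

variable [DecidableEq W] [DecidableEq A] {F : Fin k → D.Sub} {i : Fin k} {e : A}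

/-- The family `F` with the arc `e` added to its `i`-th member. -/
def augment (F : Fin k → D.Sub) (i : Fin k) (e : A) (he : D.tail e ∈ (F i).verts) :
    Fin k → D.Sub :=
  Function.update F i ((F i).addArc e he)

theorem augment_verts (he : D.tail e ∈ (F i).verts) (j : Fin k) :
    (augment F i e he j).verts = if j = i then insert (D.head e) (F j).verts else (F j).verts := by
  by_cases h : j = i
  · subst h; simp [augment, Sub.addArc]
  · simp [augment, h]

theorem augment_arcs (he : D.tail e ∈ (F i).verts) (j : Fin k) :
    (augment F i e he j).arcs = if j = i then insert e (F j).arcs else (F j).arcs := by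
  by_cases h : j = i
  · subst h; simp [augment, Sub.addArc]
  · simp [augment, h]

theorem isSubOf_augment (he : D.tail e ∈ (F i).verts) (j : Fin k) :
    (F j).IsSubOf (augment F i e he j) := by
  rw [Sub.IsSubOf, augment_verts, augment_arcs]
  split_ifs <;> simp

theorem missing_augment (he : D.tail e ∈ (F i).verts) (I : Finset (Fin k)) (X : Finset W) :
    missing (augment F i e he) I X = missing F (if D.head e ∈ X then I.erase i else I) X := by
  ext j
  rw [mem_missing, augment_verts]
  by_cases h : j = i <;> by_cases hX : D.head e ∈ X <;>
    simp [h, hX, mem_missing, Finset.disjoint_insert_right]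

theorem freeArcs_augment [Fintype A] (he : D.tail e ∈ (F i).verts) :
    freeArcs (augment F i e he) = (freeArcs F).erase e := by
  ext a
  simp only [mem_freeArcs, Finset.mem_erase, augment_arcs]
  refine ⟨fun h => ⟨fun hae => by simpa [hae] using h i, fun j => ?_⟩, fun h j => ?_⟩
  · have := h j; grind
  · have := h.2 j; grind

theorem IsArborescencePacking.augment [Fintype A] {x : W} (hF : IsArborescencePacking F x)
    (he : D.tail e ∈ (F i).verts) (he' : D.head e ∉ (F i).verts) (hfree : e ∈ freeArcs F) :
    IsArborescencePacking (augment F i e he) x := by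
  refine ⟨fun j => ?_, fun j j' hjj' => ?_⟩
  · by_cases h : j = i
    · subst h; simpa [MultiDigraph.augment] using (hF.isArborescence j).addArc he he'
    · simpa [MultiDigraph.augment, h] using hF.isArborescence j
  · have hj := mem_freeArcs.1 hfree j
    have hj' := mem_freeArcs.1 hfree j'
    have hdisj := hF.arcDisjoint j j' hjj'
    rw [augment_arcs, augment_arcs]
    rw [Finset.disjoint_left] at hdisj ⊢
    grind

end Families

end MultiDigraph

namespace MultiDigraph

section Deficit

variable {W A : Type*} [Fintype W] [DecidableEq W] {D : MultiDigraph W A} {k : ℕ}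

theorem inDeg_eq_sum (B : Finset A) (X : Finset W) :
    D.inDeg B X = ∑ a ∈ B, if D.tail a ∉ X ∧ D.head a ∈ X then 1 else 0 := by
  simp only [inDeg, numArcs, Finset.mem_compl, Finset.card_filter]

theorem inDeg_inter_add_inDeg_union_le (B : Finset A) (X Y : Finset W) :
    D.inDeg B (X ∩ Y) + D.inDeg B (X ∪ Y) ≤ D.inDeg B X + D.inDeg B Y := by
  simp only [inDeg_eq_sum, ← Finset.sum_add_distrib, Finset.mem_inter, Finset.mem_union]
  refine Finset.sum_le_sum fun a _ => ?_
  grind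

theorem inDeg_univ (B : Finset A) : D.inDeg B Finset.univ = 0 := by
  simp [inDeg_eq_sum]

theorem exists_entering_of_inDeg_lt {B : Finset A} {X Y : Finset W}
    (h : D.inDeg B X < D.inDeg B Y) :
    ∃ a ∈ B, D.tail a ∉ Y ∧ D.head a ∈ Y ∧ ¬ (D.tail a ∉ X ∧ D.head a ∈ X) := by
  by_contra! hcon
  refine h.not_ge (Finset.card_le_card fun a ha => ?_)
  simp only [Finset.mem_filter, Finset.mem_compl] at ha ⊢
  exact ⟨ha.1, hcon a ha.1 ha.2.1 ha.2.2⟩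

/-- `|P_I(X)| - d⁻_B(X)`: the number of members of `F` with index in `I` that have yet to enter
`X`, minus the number of arcs of `B` available for this. -/
def deficit (F : Fin k → D.Sub) (B : Finset A) (I : Finset (Fin k)) (X : Finset W) : ℤ :=
  (missing F I X).card - D.inDeg B X

variable {F : Fin k → D.Sub} {B : Finset A} {I J : Finset (Fin k)} {X : Finset W} {i : Fin k}

theorem deficit_mono (h : I ⊆ J) : deficit F B I X ≤ deficit F B J X :=
  sub_le_sub_right (mod_cast Finset.card_le_card (Finset.filter_subset_filter _ h)) _

theorem deficit_erase_lt (hi : i ∈ I) (hX : Disjoint X (F i).verts) :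
    deficit F B (I.erase i) X < deficit F B I X := by
  rw [deficit, missing, Finset.filter_erase]
  exact sub_lt_sub_right
    (mod_cast Finset.card_erase_lt_of_mem (mem_missing.2 ⟨hi, hX⟩)) _

theorem isBisupermodular_deficit : IsBisupermodular (deficit F B) := by
  intro I J X Y _
  have hunion : missing F I X ∪ missing F J Y ⊆ missing F (I ∪ J) (X ∩ Y) := by
    intro i
    simp only [Finset.mem_union, mem_missing]
    rintro (⟨hi, h⟩ | ⟨hi, h⟩)
    · exact ⟨Or.inl hi, h.mono_left Finset.inter_subset_left⟩
    · exact ⟨Or.inr hi, h.mono_left Finset.inter_subset_right⟩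
  have hinter : missing F I X ∩ missing F J Y ⊆ missing F (I ∩ J) (X ∪ Y) := by
    intro i
    simp only [Finset.mem_inter, mem_missing, Finset.disjoint_union_left]
    tauto
  have hcard := Finset.card_union_add_card_inter (missing F I X) (missing F J Y)
  have hin := inDeg_inter_add_inDeg_union_le (D := D) B X Y
  have := Finset.card_le_card hunion
  have := Finset.card_le_card hinter
  simp only [deficit]
  lia

theorem deficit_erase_arc [DecidableEq A] {e : A} (he : e ∈ B) :
    deficit F (B.erase e) I X =
      deficit F B I X + if D.tail e ∉ X ∧ D.head e ∈ X then 1 else 0 := by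
  rw [deficit, deficit, inDeg_eq_sum, inDeg_eq_sum, ← Finset.sum_erase_add _ _ he]
  push_cast
  ring

theorem deficit_augment [DecidableEq A] {e : A} (he : D.tail e ∈ (F i).verts) :
    deficit (augment F i e he) B I X =
      deficit F B (if D.head e ∈ X then I.erase i else I) X := by
  rw [deficit, missing_augment, deficit]

end Deficit

section Edmonds

variable {W A : Type*} [Fintype W] [DecidableEq W] {D : MultiDigraph W A} {k : ℕ}
  {F : Fin k → D.Sub} {B : Finset A} {x : W}

/-- The arc is chosen inside a minimal tight set that is not contained in `F i`. -/
theorem exists_safe_arc (hcov : ∀ X : Finset W, X.Nonempty → deficit F B Finset.univ X ≤ 0)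
    {i : Fin k} {v : W} (hv : v ∉ (F i).verts) :
    ∃ e ∈ B, D.tail e ∈ (F i).verts ∧ D.head e ∉ (F i).verts ∧
      ∀ X, D.tail e ∉ X → D.head e ∈ X → deficit F B (Finset.univ.erase i) X < 0 := by
  set J := Finset.univ.erase i
  set U := (F i).verts
  have hcov' : ∀ I, ∀ X : Finset W, X.Nonempty → deficit F B I X ≤ 0 := fun I X hX =>
    (deficit_mono (Finset.subset_univ I)).trans (hcov X hX)
  obtain ⟨X, ⟨htight, hXU⟩, hmin⟩ :=
    (Set.toFinite {X | 0 ≤ deficit F B J X ∧ (X \ U).Nonempty}).exists_minimal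
      ⟨Finset.univ, by simp [deficit, inDeg_univ], v, by simpa using hv⟩
  have hlt : (missing F J X).card < (missing F Finset.univ (X \ U)).card := by
    refine Finset.card_lt_card (Finset.ssubset_iff_subset_ne.2 ⟨fun j hj => ?_, fun h => ?_⟩)
    · exact mem_missing.2 ⟨Finset.mem_univ j, (mem_missing.1 hj).2.mono_left Finset.sdiff_subset⟩
    · have hi : i ∈ missing F J X := h ▸ mem_missing.2 ⟨Finset.mem_univ i, Finset.sdiff_disjoint⟩
      exact Finset.notMem_erase i _ (mem_missing.1 hi).1
  obtain ⟨e, he, het, heh, hne⟩ : ∃ a ∈ B, D.tail a ∉ X \ U ∧ D.head a ∈ X \ U ∧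
      ¬ (D.tail a ∉ X ∧ D.head a ∈ X) := by
    refine exists_entering_of_inDeg_lt ?_
    have := hcov _ hXU
    simp only [deficit] at this hlt htight
    lia
  rw [Finset.mem_sdiff] at het heh
  have hetX : D.tail e ∈ X := by tauto
  refine ⟨e, he, by tauto, heh.2, fun Z htZ hhZ => ?_⟩
  by_contra! hZ
  have hmem : D.head e ∈ X ∩ Z := Finset.mem_inter.2 ⟨heh.1, hhZ⟩
  have htight' := (isBisupermodular_deficit.nonneg_of_nonneg hcov' htight hZ ⟨_, hmem⟩).1
  rw [Finset.union_self] at htight'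
  have hsub := hmin ⟨htight', D.head e, Finset.mem_sdiff.2 ⟨hmem, heh.2⟩⟩ Finset.inter_subset_left
  exact htZ (Finset.mem_inter.1 (hsub hetX)).2

theorem exists_isSpanningExtension [Fintype A] [DecidableEq A] (hF : IsArborescencePacking F x)
    (hB : B ⊆ freeArcs F) (hcov : ∀ X : Finset W, X.Nonempty → deficit F B Finset.univ X ≤ 0) :
    ∃ F' : Fin k → D.Sub, IsSpanningExtension F F' x ∧
      ∀ i, (F' i).arcs ⊆ (F i).arcs ∪ B := by
  induction B using Finset.strongInduction generalizing F with
  | H B ih =>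
    by_cases hspan : ∀ i, (F i).IsSpanning
    · exact ⟨F, ⟨hF, hspan, fun i => .refl _⟩, fun i => Finset.subset_union_left⟩
    obtain ⟨i, v, hv⟩ : ∃ i, ∃ v, v ∉ (F i).verts := by simpa [Sub.IsSpanning] using hspan
    obtain ⟨e, he, het, heh, hsafe⟩ := exists_safe_arc hcov hv
    have hB' : B.erase e ⊆ freeArcs (augment F i e het) :=
      freeArcs_augment (F := F) het ▸ Finset.erase_subset_erase e hB
    have hcov' : ∀ X : Finset W, X.Nonempty →
        deficit (augment F i e het) (B.erase e) Finset.univ X ≤ 0 := by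
      intro X hX
      rw [deficit_augment, deficit_erase_arc he]
      split_ifs with hX₁ hX₂ hX₂
      · exact hsafe X hX₂.1 hX₁
      · simpa using (deficit_mono (Finset.erase_subset i _)).trans (hcov X hX)
      · exact absurd hX₂.2 hX₁
      · simpa using hcov X hX
    obtain ⟨F', hF', harcs⟩ := ih (B.erase e) (Finset.erase_ssubset he)
      (hF.augment het heh (hB he)) hB' hcov'
    refine ⟨F', ⟨hF'.isPacking, hF'.isSpanning,
      fun j => (isSubOf_augment het j).trans (hF'.isSubOf j)⟩, fun j => (harcs j).trans ?_⟩
    rw [augment_arcs]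
    grind

end Edmonds

end MultiDigraph

section Labels

variable {ι Λ V : Type*} [Fintype ι] [DecidableEq Λ] {κ : ι → Λ}

/-- The set of indices whose label belongs to `S`; the parts `I_α` are encoded by a labelling `κ` of
the indices as the sets `indicesOf κ {α}`. -/
def indicesOf (κ : ι → Λ) (S : Finset Λ) : Finset ι :=
  Finset.univ.filter fun i => κ i ∈ S

theorem mem_indicesOf {S : Finset Λ} {i : ι} : i ∈ indicesOf κ S ↔ κ i ∈ S := by
  simp [indicesOf]

theorem indicesOf_union [DecidableEq ι] (κ : ι → Λ) (S T : Finset Λ) :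
    indicesOf κ (S ∪ T) = indicesOf κ S ∪ indicesOf κ T := by
  ext i; simp [mem_indicesOf]

theorem indicesOf_inter [DecidableEq ι] (κ : ι → Λ) (S T : Finset Λ) :
    indicesOf κ (S ∩ T) = indicesOf κ S ∩ indicesOf κ T := by
  ext i; simp [mem_indicesOf]

theorem indicesOf_compl [DecidableEq ι] [Fintype Λ] (κ : ι → Λ) (S : Finset Λ) :
    indicesOf κ Sᶜ = (indicesOf κ S)ᶜ := by
  ext i; simp [mem_indicesOf]

theorem indicesOf_univ [Fintype Λ] (κ : ι → Λ) : indicesOf κ Finset.univ = Finset.univ := by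
  ext i; simp [mem_indicesOf]

theorem sum_indicesOf {M : Type*} [AddCommMonoid M] (κ : ι → Λ) (S : Finset Λ) (f : ι → M) :
    ∑ i ∈ indicesOf κ S, f i = ∑ α ∈ S, ∑ i ∈ indicesOf κ {α}, f i := by
  rw [← Finset.sum_fiberwise_of_maps_to fun i hi => mem_indicesOf.1 hi]
  refine Finset.sum_congr rfl fun α hα => Finset.sum_congr ?_ fun _ _ => rfl
  ext i
  simp only [Finset.mem_filter, mem_indicesOf, Finset.mem_singleton]
  grind

theorem IsBisupermodular.comp_indicesOf [DecidableEq ι] [DecidableEq V]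
    {p : Finset ι → Finset V → ℤ} (hp : IsBisupermodular p) (κ : ι → Λ) :
    IsBisupermodular fun S X => p (indicesOf κ S) X := by
  intro S T X Y h
  simpa only [indicesOf_union, indicesOf_inter] using hp _ _ X Y h

end Labels

namespace MultiDigraph

variable {W A : Type*} [DecidableEq W] {D : MultiDigraph W A} {k : ℕ} {F : Fin k → D.Sub} {x : W}

theorem numArcs_erase_add [DecidableEq A] {B : Finset A} {e : A} (he : e ∈ B) (X Y : Finset W) :
    D.numArcs (B.erase e) X Y + (if D.tail e ∈ X ∧ D.head e ∈ Y then 1 else 0) =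
      D.numArcs B X Y := by
  simp only [numArcs, Finset.card_filter]
  exact Finset.sum_erase_add B _ he

section RootDegree

variable [Fintype W] {I : Finset (Fin k)} {i : Fin k} {e : A}

/-- The total out-degree of `x` in the members of `F` with index in `I`. -/
def rootDeg (F : Fin k → D.Sub) (x : W) (I : Finset (Fin k)) : ℕ :=
  ∑ i ∈ I, D.outDeg (F i).arcs x

theorem outDeg_eq_card_outArcs (B : Finset A) (x : W) : D.outDeg B x = (D.outArcs B x).card := by
  rw [outDeg, numArcs, outArcs]
  congr 1
  refine Finset.filter_congr fun a _ => ?_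
  have := D.tail_ne_head a
  simp only [Finset.mem_singleton, Finset.mem_compl]
  grind

theorem rootDeg_augment [Fintype A] [DecidableEq A] (hfree : e ∈ freeArcs F)
    (he : D.tail e ∈ (F i).verts) (hx : D.tail e = x) :
    rootDeg (augment F i e he) x I = rootDeg F x I + if i ∈ I then 1 else 0 := by
  have hout : ∀ j, D.outDeg (augment F i e he j).arcs x =
      D.outDeg (F j).arcs x + if j = i then 1 else 0 := fun j => by
    rw [augment_arcs]
    split_ifs with hj
    · simp [outDeg_eq_card_outArcs, outArcs, Finset.filter_insert, hx, mem_freeArcs.1 hfree j]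
    · rfl
  simp [rootDeg, hout, Finset.sum_add_distrib]

end RootDegree

section InnerArcs

variable [Fintype A] [DecidableEq A]

/-- The arcs of `D` that belong to no member of `F` and whose tail is not `x`. -/
def innerArcs (F : Fin k → D.Sub) (x : W) : Finset A := freeArcs F \ D.outArcs Finset.univ x

theorem mem_innerArcs {a : A} : a ∈ innerArcs F x ↔ a ∈ freeArcs F ∧ D.tail a ≠ x := by
  simp [innerArcs, outArcs]

theorem innerArcs_augment {i : Fin k} {e : A} (he : D.tail e ∈ (F i).verts) (hx : D.tail e = x) :
    innerArcs (augment F i e he) x = innerArcs F x := by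
  ext a
  simp only [mem_innerArcs, freeArcs_augment, Finset.mem_erase]
  grind

end InnerArcs

section RootPlan

variable [Fintype W] {Λ : Type*} [DecidableEq Λ] {κ : Fin k → Λ} {B : Finset A} {m : Matrix Λ W ℕ}
  {α : Λ} {u : W}

theorem nonempty_missing_of_le_deficit {S : Finset Λ} {X : Finset W} (hα : α ∈ S) (hu : u ∈ X)
    (hcov : deficit F B (indicesOf κ (S.erase α)) X ≤
      blockSum (m + Matrix.single α u 1) (S.erase α) X)
    (hS : blockSum (m + Matrix.single α u 1) S X ≤ deficit F B (indicesOf κ S) X) :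
    (missing F (indicesOf κ {α}) X).Nonempty := by
  by_contra! hempty
  have hsub : missing F (indicesOf κ S) X ⊆ missing F (indicesOf κ (S.erase α)) X := fun i hi => by
    have hiα : i ∉ missing F (indicesOf κ {α}) X := hempty ▸ Finset.notMem_empty i
    simp only [mem_missing, mem_indicesOf, Finset.mem_singleton, Finset.mem_erase] at hi hiα ⊢
    tauto
  have hcard := Finset.card_le_card hsub
  have hblock := blockSum_mono m X (Finset.erase_subset α S)
  simp only [blockSum_add, blockSum_single, hα, hu, Finset.notMem_erase, deficit] at hcov hS
  lia

/-- The index is one missing the largest tight set that contains `u`. -/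
theorem exists_safe_index
    (hcov : ∀ S, ∀ X : Finset W, X.Nonempty →
      deficit F B (indicesOf κ S) X ≤ blockSum (m + Matrix.single α u 1) S X)
    (hu : (missing F (indicesOf κ {α}) {u}).Nonempty) :
    ∃ i, κ i = α ∧ u ∉ (F i).verts ∧
      ∀ S X, u ∈ X → deficit F B ((indicesOf κ S).erase i) X ≤ blockSum m S X := by
  set p : Finset Λ → Finset W → ℤ := fun S X =>
    deficit F B (indicesOf κ S) X - blockSum (m + Matrix.single α u 1) S X with hp_def
  have hp : IsBisupermodular p :=
    (isBisupermodular_deficit.comp_indicesOf κ).sub_blockSum (m + Matrix.single α u 1)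
  have hp₀ : ∀ S X, X.Nonempty → p S X ≤ 0 := fun S X hX => sub_nonpos.2 (hcov S X hX)
  obtain ⟨Z, ⟨huZ, hZ⟩, hmax⟩ :=
    (Set.toFinite {X : Finset W | u ∈ X ∧ (X = {u} ∨ ∃ S, α ∈ S ∧ 0 ≤ p S X)}).exists_maximal
      ⟨{u}, by simp⟩
  obtain ⟨i, hi⟩ : (missing F (indicesOf κ {α}) Z).Nonempty := by
    rcases hZ with rfl | ⟨S, hαS, hS⟩
    · exact hu
    · exact nonempty_missing_of_le_deficit hαS huZ (hcov _ Z ⟨u, huZ⟩) (sub_nonneg.1 hS)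
  rw [mem_missing, mem_indicesOf, Finset.mem_singleton] at hi
  refine ⟨i, hi.1, Finset.disjoint_left.1 hi.2 huZ, fun S X huX => ?_⟩
  have hcovX := hcov S X ⟨u, huX⟩
  rw [blockSum_add, blockSum_single] at hcovX
  by_cases hαS : α ∈ S
  · by_contra! hlt
    have hX : 0 ≤ p S X := by
      have := deficit_mono (F := F) (B := B) (X := X) (Finset.erase_subset i (indicesOf κ S))
      simp only [hp_def, blockSum_add, blockSum_single, hαS, huX]
      lia
    have hXZ : X ∪ Z = {u} ∨ ∃ R, α ∈ R ∧ 0 ≤ p R (X ∪ Z) := by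
      rcases hZ with rfl | ⟨R, hαR, hR⟩
      · exact Or.inr ⟨S, hαS, by rwa [Finset.union_eq_left.2 (Finset.singleton_subset_iff.2 huX)]⟩
      · exact Or.inr ⟨S ∩ R, Finset.mem_inter.2 ⟨hαS, hαR⟩,
          (hp.nonneg_of_nonneg hp₀ hX hR ⟨u, Finset.mem_inter.2 ⟨huX, huZ⟩⟩).2⟩
    have hsub : X ⊆ Z := Finset.subset_union_left.trans
      (hmax ⟨Finset.mem_union_left Z huX, hXZ⟩ Finset.subset_union_right)
    have := deficit_erase_lt (B := B) (mem_indicesOf.2 (hi.1.symm ▸ hαS)) (hi.2.mono_left hsub)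
    simp only [hαS, huX] at hcovX
    lia
  · rw [Finset.erase_eq_of_notMem fun h => hαS (hi.1 ▸ mem_indicesOf.1 h)]
    simpa [hαS] using hcovX

/-- `m α u` new arcs from `x` to `u` are to be given to the members of `F` with label `α`. By
`covers` the arcs not leaving `x` then suffice to make all members spanning; the other conditions
say that there are enough members avoiding `u` and enough free arcs from `x` to `u`. -/
structure IsRootPlan [Fintype A] [DecidableEq A] [Fintype Λ] (F : Fin k → D.Sub) (x : W)
    (κ : Fin k → Λ) (m : Matrix Λ W ℕ) : Prop where
  covers : ∀ S, ∀ X : Finset W, X.Nonempty →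
    deficit F (innerArcs F x) (indicesOf κ S) X ≤ blockSum m S X
  le_missing : ∀ α u, m α u ≤ (missing F (indicesOf κ {α}) {u}).card
  le_numArcs : ∀ u, blockSum m Finset.univ {u} ≤ D.numArcs (freeArcs F) {x} {u}

variable [Fintype A] [DecidableEq A] [Fintype Λ]

theorem IsRootPlan.augment {i : Fin k} {e : A}
    (hm : IsRootPlan F x κ (m + Matrix.single (κ i) (D.head e) 1)) (hfree : e ∈ freeArcs F)
    (he : D.tail e ∈ (F i).verts) (hx : D.tail e = x)
    (hsafe : ∀ S X, D.head e ∈ X →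
      deficit F (innerArcs F x) ((indicesOf κ S).erase i) X ≤ blockSum m S X) :
    IsRootPlan (augment F i e he) x κ m where
  covers S X hX := by
    rw [innerArcs_augment he hx, deficit_augment]
    split_ifs with hu
    · exact hsafe S X hu
    · simpa [blockSum_add, blockSum_single, hu] using hm.covers S X hX
  le_missing α u := by
    have := hm.le_missing α u
    rw [Matrix.add_apply, Matrix.single_apply] at this
    simp only [missing_augment, Finset.mem_singleton]
    by_cases hu : D.head e = u
    · rw [if_pos hu, missing, Finset.filter_erase]
      by_cases hα : κ i = α
      · have := Finset.pred_card_le_card_erase (s := missing F (indicesOf κ {α}) {u}) (a := i)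
        simp only [hu, hα, missing] at *
        lia
      · rw [Finset.erase_eq_of_notMem (by simp [mem_indicesOf, hα])]
        simpa [hα, missing] using this
    · simpa [hu] using this
  le_numArcs u := by
    have := hm.le_numArcs u
    rw [blockSum_add, blockSum_single, ← numArcs_erase_add hfree, ← freeArcs_augment he] at this
    simpa [hx] using this

theorem exists_root_extension (hF : IsArborescencePacking F x) (hm : IsRootPlan F x κ m) :
    ∃ F' : Fin k → D.Sub, IsArborescencePacking F' x ∧ (∀ i, (F i).IsSubOf (F' i)) ∧
      (∀ X : Finset W, X.Nonempty → deficit F' (innerArcs F' x) Finset.univ X ≤ 0) ∧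
      ∀ S, rootDeg F' x (indicesOf κ S) =
        rootDeg F x (indicesOf κ S) + blockSum m S Finset.univ := by
  induction hn : blockSum m Finset.univ Finset.univ generalizing F m with
  | zero =>
    have hblock : ∀ S X, blockSum m S X = 0 := fun S X =>
      Nat.eq_zero_of_le_zero (hn ▸ Finset.sum_le_sum_of_subset (Finset.product_subset_product
        (Finset.subset_univ S) (Finset.subset_univ X)))
    refine ⟨F, hF, fun i => .refl _, fun X hX => ?_, fun S => by rw [hblock, add_zero]⟩
    simpa [indicesOf_univ, hblock] using hm.covers Finset.univ X hX
  | succ n ih =>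
    obtain ⟨⟨α, u⟩, -, hαu⟩ := Finset.exists_ne_zero_of_sum_ne_zero (hn.trans_ne n.succ_ne_zero)
    obtain ⟨m, rfl⟩ := exists_eq_add_single hαu
    have hu : (missing F (indicesOf κ {α}) {u}).Nonempty :=
      Finset.card_pos.1 ((Nat.pos_of_ne_zero hαu).trans_le (hm.le_missing α u))
    obtain ⟨i, rfl, hui, hsafe⟩ := exists_safe_index hm.covers hu
    obtain ⟨e, he⟩ : ((freeArcs F).filter fun a => D.tail a ∈ ({x} : Finset W) ∧
        D.head a ∈ ({u} : Finset W)).Nonempty := by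
      have := hm.le_numArcs u
      rw [blockSum_add, blockSum_single, if_pos (by simp)] at this
      exact Finset.card_pos.1 (Nat.lt_of_lt_of_le (Nat.succ_pos _) this)
    simp only [Finset.mem_filter, Finset.mem_singleton] at he
    obtain ⟨hfree, hx, rfl⟩ := he
    have he : D.tail e ∈ (F i).verts := hx ▸ (hF.isArborescence i).1
    rw [blockSum_add, blockSum_single, if_pos (by simp), Nat.succ_inj] at hn
    obtain ⟨F', hF', hsub, hcov, hdeg⟩ :=
      ih (hF.augment he hui hfree) (hm.augment hfree he hx hsafe) hn
    refine ⟨F', hF', fun j => (isSubOf_augment he j).trans (hsub j), hcov, fun S => ?_⟩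
    rw [hdeg, rootDeg_augment hfree he hx, blockSum_add, blockSum_single]
    simp only [mem_indicesOf, Finset.mem_univ, and_true]
    ring

end RootPlan

end MultiDigraph

section Subpartition

variable {V : Type*} [DecidableEq V] {t : ℕ} {U Y : Finset V} {X : Fin t → Finset V}

/-- The sets `X₁, …, Xₜ` are nonempty, pairwise disjoint subsets of `U`. -/
structure IsSubpartition (U : Finset V) (X : Fin t → Finset V) : Prop where
  nonempty : ∀ j, (X j).Nonempty
  subset : ∀ j, X j ⊆ U
  disjoint : ∀ j j', j ≠ j' → Disjoint (X j) (X j')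

theorem IsSubpartition.cons (hX : IsSubpartition (U \ Y) X) (hY : Y.Nonempty) (hYU : Y ⊆ U) :
    IsSubpartition U (Fin.cons Y X : Fin (t + 1) → Finset V) := by
  have hdisj : ∀ j, Disjoint Y (X j) := fun j => Finset.disjoint_sdiff.mono_right (hX.subset j)
  refine ⟨Fin.cases hY hX.nonempty,
    Fin.cases hYU fun j => (hX.subset j).trans Finset.sdiff_subset, ?_⟩
  refine Fin.cases (Fin.cases (fun h => absurd rfl h) fun j _ => hdisj j) fun i =>
    Fin.cases (fun _ => (hdisj i).symm) fun j hij => ?_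
  exact hX.disjoint i j fun h => hij (h ▸ rfl)

omit [DecidableEq V] in
theorem IsSubpartition.mono {U' : Finset V} (hX : IsSubpartition U X) (hU : U ⊆ U') :
    IsSubpartition U' X :=
  ⟨hX.nonempty, fun j => (hX.subset j).trans hU, hX.disjoint⟩

theorem IsSubpartition.sum_eq (hX : IsSubpartition U X) (f : V → ℤ) :
    ∑ u ∈ U, f u = ∑ j, ∑ u ∈ X j, f u + ∑ u ∈ U \ Finset.univ.biUnion X, f u := by
  rw [← Finset.sum_biUnion fun j _ j' _ h => hX.disjoint j j' h, add_comm]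
  exact (Finset.sum_sdiff (Finset.biUnion_subset.2 fun j _ => hX.subset j)).symm

end Subpartition

namespace MultiDigraph

variable {W A : Type*} [Fintype W] [DecidableEq W] {D : MultiDigraph W A} {k : ℕ}
  {F : Fin k → D.Sub} {x : W}

section RootArcs

variable {B : Finset A} {X Y : Finset W} {u : W}

omit [Fintype W] in
theorem numArcs_eq_sum (B : Finset A) (X Y : Finset W) :
    D.numArcs B X Y = ∑ u ∈ Y, D.numArcs B X {u} := by
  simp only [numArcs, Finset.mem_singleton]
  rw [Finset.card_eq_sum_card_fiberwise (f := D.head) (t := Y)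
    fun a ha => (Finset.mem_filter.1 ha).2.2]
  refine Finset.sum_congr rfl fun u hu => ?_
  rw [Finset.filter_filter]
  congr 1
  grind

omit [Fintype W] in
theorem numArcs_self (B : Finset A) (x : W) : D.numArcs B {x} {x} = 0 := by
  simp only [numArcs, Finset.mem_singleton, Finset.card_eq_zero, Finset.filter_eq_empty_iff]
  exact fun a _ h => D.tail_ne_head a (h.1.trans h.2.symm)

omit [Fintype W] in
theorem weight_eq_min [Fintype A] [DecidableEq A] (F : Fin k → D.Sub) (x : W)
    (I : Finset (Fin k)) (u : W) :
    weight F x I u = min (missing F I {u}).card (D.numArcs (freeArcs F) {x} {u}) := by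
  simp only [missing, Finset.disjoint_singleton_left]
  rw [weight]
  split_ifs with hu
  · rfl
  · have hzero : D.numArcs (freeArcs F) {x} {u} = 0 := by
      simp only [outNbrs, outArcs, Finset.mem_image, Finset.mem_filter, not_exists] at hu
      simp only [numArcs, Finset.mem_singleton, Finset.card_eq_zero, Finset.filter_eq_empty_iff]
      exact fun a _ h => hu a ⟨⟨Finset.mem_univ a, h.1⟩, h.2⟩
    rw [hzero, Nat.min_zero]

theorem inDeg_eq_add_numArcs [Fintype A] [DecidableEq A] (hx : x ∉ X) :
    D.inDeg B X = D.inDeg (B \ D.outArcs Finset.univ x) X + D.numArcs B {x} X := by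
  rw [inDeg, inDeg, numArcs, numArcs, numArcs, ← Finset.card_union_of_disjoint]
  · congr 1
    ext a
    simp only [outArcs, Finset.mem_union, Finset.mem_filter, Finset.mem_sdiff, Finset.mem_compl,
      Finset.mem_singleton]
    grind
  · rw [Finset.disjoint_left]
    simp only [outArcs, Finset.mem_filter, Finset.mem_sdiff, Finset.mem_singleton]
    grind

theorem deficit_innerArcs [Fintype A] [DecidableEq A] {I : Finset (Fin k)} (hx : x ∉ X) :
    deficit F (innerArcs F x) I X =
      deficit F (freeArcs F) I X + D.numArcs (freeArcs F) {x} X := by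
  rw [deficit, deficit, inDeg_eq_add_numArcs (B := freeArcs F) hx, innerArcs]
  push_cast
  ring

end RootArcs

section Demand

variable [Fintype A] [DecidableEq A] {I J : Finset (Fin k)} {X Y : Finset W}

/-- For `X = {u}`: the number of free arcs from `x` to `u`, minus the number of members of `F` with
index outside `I` that can still use one of them. -/
def surplus (F : Fin k → D.Sub) (x : W) (I : Finset (Fin k)) (X : Finset W) : ℤ :=
  D.numArcs (freeArcs F) {x} X - (missing F Iᶜ X).card

omit [Fintype W] in
theorem surplus_mono (h : I ⊆ J) : surplus F x I X ≤ surplus F x J X :=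
  sub_le_sub_left (mod_cast Finset.card_le_card
    (Finset.filter_subset_filter _ (Finset.compl_subset_compl.2 h))) _

omit [Fintype W] in
theorem max_zero_surplus_singleton (u : W) : max 0 (surplus F x I {u}) =
    D.numArcs (freeArcs F) {x} {u} - weight F x Iᶜ u := by
  rw [weight_eq_min, surplus]
  lia

omit [Fintype W] in
theorem surplus_add_surplus_le : surplus F x I X + surplus F x J X ≤
    surplus F x (I ∪ J) X + surplus F x (I ∩ J) X := by
  have hcard := Finset.card_union_add_card_inter (missing F Iᶜ X) (missing F Jᶜ X)
  have hunion : missing F (I ∩ J)ᶜ X = missing F Iᶜ X ∪ missing F Jᶜ X := by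
    rw [Finset.compl_inter, missing, Finset.filter_union, missing, missing]
  have hinter : missing F (I ∪ J)ᶜ X = missing F Iᶜ X ∩ missing F Jᶜ X := by
    rw [Finset.compl_union, missing, Finset.filter_inter_distrib, missing, missing]
  rw [surplus, surplus, surplus, surplus, hunion, hinter]
  lia

theorem surplus_add_deficit_le {B : Finset A} (h : X ⊆ Y) :
    surplus F x I X + deficit F B J Y ≤ surplus F x (I ∪ J) X + deficit F B (I ∩ J) Y := by
  have hsub : missing F J Y \ missing F (I ∩ J) Y ⊆ missing F Iᶜ X \ missing F (I ∪ J)ᶜ X := by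
    intro i
    have := fun hY : Disjoint Y (F i).verts => hY.mono_left h
    simp only [Finset.mem_sdiff, mem_missing, Finset.mem_compl, Finset.mem_union,
      Finset.mem_inter]
    tauto
  have hJ : missing F (I ∩ J) Y ⊆ missing F J Y :=
    Finset.filter_subset_filter _ Finset.inter_subset_right
  have hI : missing F (I ∪ J)ᶜ X ⊆ missing F Iᶜ X :=
    Finset.filter_subset_filter _ (Finset.compl_subset_compl.2 Finset.subset_union_left)
  have := Finset.card_le_card hsub
  have := Finset.card_sdiff_add_card_eq_card hJ
  have := Finset.card_sdiff_add_card_eq_card hI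
  simp only [surplus, deficit]
  lia

variable {Λ : Type*} [DecidableEq Λ]

/-- The number of new arcs from `x` into `X` with label in `S` that are required; the arcs that stay
unused have the label `none`. -/
def demand (F : Fin k → D.Sub) (x : W) (κ : Fin k → Option Λ) (S : Finset (Option Λ))
    (X : Finset W) : ℤ :=
  if none ∈ S ∧ X.card = 1 then
    max (deficit F (innerArcs F x) (indicesOf κ S) X) (surplus F x (indicesOf κ S) X)
  else deficit F (innerArcs F x) (indicesOf κ S) X

variable {κ : Fin k → Option Λ} {S T : Finset (Option Λ)}

theorem deficit_le_demand :
    deficit F (innerArcs F x) (indicesOf κ S) X ≤ demand F x κ S X := by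
  rw [demand]; split_ifs <;> simp

theorem surplus_le_demand (hS : none ∈ S) (hX : X.card = 1) :
    surplus F x (indicesOf κ S) X ≤ demand F x κ S X := by
  rw [demand, if_pos ⟨hS, hX⟩]; exact le_max_right _ _

theorem demand_cases (F : Fin k → D.Sub) (x : W) (κ : Fin k → Option Λ) (S : Finset (Option Λ))
    (X : Finset W) :
    demand F x κ S X = deficit F (innerArcs F x) (indicesOf κ S) X ∨
      none ∈ S ∧ X.card = 1 ∧ demand F x κ S X = surplus F x (indicesOf κ S) X := by
  grind [demand]

theorem demand_nonpos (hF : ∀ i, x ∈ (F i).verts) (hx : x ∈ X) : demand F x κ S X ≤ 0 := by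
  have hmissing : ∀ I, missing F I X = ∅ := fun I =>
    Finset.filter_eq_empty_iff.2 fun i _ h => Finset.disjoint_left.1 h hx (hF i)
  rcases demand_cases F x κ S X with h | ⟨-, hX, h⟩
  · simp [h, deficit, hmissing]
  · rw [Finset.card_eq_one] at hX
    obtain ⟨u, rfl⟩ := hX
    obtain rfl := Finset.mem_singleton.1 hx
    simp [h, surplus, hmissing, numArcs_self]

theorem surplus_add_demand_le (hS : none ∈ S) (hX : X.card = 1) (hXY : X ⊆ Y) :
    surplus F x (indicesOf κ S) X + demand F x κ T Y ≤
      demand F x κ (S ∪ T) X + demand F x κ (S ∩ T) Y := by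
  have hunion := surplus_le_demand (F := F) (x := x) (κ := κ) (Finset.mem_union_left T hS) hX
  rw [indicesOf_union] at hunion
  rcases demand_cases F x κ T Y with h | ⟨hT, hY, h⟩
  · have hinter := deficit_le_demand (F := F) (x := x) (κ := κ) (S := S ∩ T) (X := Y)
    rw [indicesOf_inter] at hinter
    have := surplus_add_deficit_le (F := F) (x := x) (B := innerArcs F x) (I := indicesOf κ S)
      (J := indicesOf κ T) hXY
    linarith
  · obtain rfl : X = Y := Finset.eq_of_subset_of_card_le hXY (hY.trans hX.symm).le
    have hinter := surplus_le_demand (F := F) (x := x) (κ := κ) (Finset.mem_inter.2 ⟨hS, hT⟩) hX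
    rw [indicesOf_inter] at hinter
    have := surplus_add_surplus_le (F := F) (x := x) (X := X) (I := indicesOf κ S)
      (J := indicesOf κ T)
    linarith

theorem isBisupermodular_demand : IsBisupermodular (demand F x κ) := by
  have subset_of_card : ∀ X Y : Finset W, (X ∩ Y).Nonempty → X.card = 1 → X ⊆ Y := by
    rintro X Y ⟨v, hv⟩ hX
    obtain ⟨u, rfl⟩ := Finset.card_eq_one.1 hX
    grind
  intro S T X Y hXY
  rcases demand_cases F x κ S X with hS | ⟨hnS, hX, hS⟩
  · rcases demand_cases F x κ T Y with hT | ⟨hnT, hY, hT⟩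
    · have := (isBisupermodular_deficit (F := F) (B := innerArcs F x)).comp_indicesOf κ S T X Y hXY
      have := deficit_le_demand (F := F) (x := x) (κ := κ) (S := S ∪ T) (X := X ∩ Y)
      have := deficit_le_demand (F := F) (x := x) (κ := κ) (S := S ∩ T) (X := X ∪ Y)
      linarith
    · have hYX := subset_of_card Y X (by rwa [Finset.inter_comm]) hY
      rw [hT, add_comm, Finset.union_comm, Finset.inter_comm S, Finset.inter_eq_right.2 hYX,
        Finset.union_eq_left.2 hYX]
      exact surplus_add_demand_le hnT hY hYX
  · have hXY := subset_of_card X Y hXY hX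
    rw [hS, Finset.inter_eq_left.2 hXY, Finset.union_eq_right.2 hXY]
    exact surplus_add_demand_le hnS hX hXY

end Demand

end MultiDigraph

namespace MultiDigraph

variable {W A : Type*} [Fintype W] [DecidableEq W] [Fintype A] [DecidableEq A]
  {D : MultiDigraph W A} {k : ℕ} {F : Fin k → D.Sub} {x : W}
  {Λ : Type*} [DecidableEq Λ]

/-- The members whose demand is a surplus are singletons; they are moved to the complement of the
subpartition. -/
theorem exists_subpartition_of_hasPacking {κ : Fin k → Option Λ} {S : Finset (Option Λ)}
    {U : Finset W} {v : ℤ} (h : HasPacking (demand F x κ) S U v) :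
    ∃ (t : ℕ) (X : Fin t → Finset W), IsSubpartition U X ∧
      v ≤ ∑ j, deficit F (innerArcs F x) (indicesOf κ S) (X j) +
        if none ∈ S then ∑ u ∈ U \ Finset.univ.biUnion X, max 0 (surplus F x (indicesOf κ S) {u})
        else 0 := by
  induction h with
  | nil hv =>
    refine ⟨0, Fin.elim0, ⟨fun j => j.elim0, fun j => j.elim0, fun j => j.elim0⟩, hv.trans ?_⟩
    rw [Finset.univ_eq_empty, Finset.sum_empty, zero_add]
    split_ifs
    exacts [Finset.sum_nonneg fun u _ => le_max_left .., le_rfl]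
  | @cons U v T Y hT hY hYU _ ih =>
    obtain ⟨t, X, hX, hle⟩ := ih
    have hTS : indicesOf κ T ⊆ indicesOf κ S := fun i hi =>
      mem_indicesOf.2 (hT (mem_indicesOf.1 hi))
    rcases demand_cases F x κ T Y with h | ⟨hnT, hYc, h⟩
    · refine ⟨t + 1, Fin.cons Y X, hX.cons hY hYU, ?_⟩
      have hsdiff : U \ Finset.univ.biUnion (Fin.cons Y X : Fin (t + 1) → Finset W) =
          (U \ Y) \ Finset.univ.biUnion X := by
        ext a
        simp only [Finset.mem_sdiff, Finset.mem_biUnion, Finset.mem_univ, true_and,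
          Fin.exists_fin_succ, Fin.cons_zero, Fin.cons_succ]
        tauto
      have := deficit_mono (F := F) (B := innerArcs F x) (X := Y) hTS
      rw [hsdiff, Fin.sum_univ_succ]
      simp only [Fin.cons_zero, Fin.cons_succ]
      linarith
    · refine ⟨t, X, hX.mono Finset.sdiff_subset, ?_⟩
      obtain ⟨u, rfl⟩ := Finset.card_eq_one.1 hYc
      have hu : u ∈ U \ Finset.univ.biUnion X := by
        have := hX.subset
        simp only [Finset.mem_sdiff, Finset.mem_biUnion]
        grind
      rw [if_pos (hT hnT), sdiff_right_comm, ← Finset.erase_eq] at hle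
      rw [if_pos (hT hnT), ← Finset.add_sum_erase _ _ hu]
      have := surplus_mono (F := F) (x := x) (X := {u}) hTS
      have := le_max_right 0 (surplus F x (indicesOf κ S) {u})
      linarith

section RootPlan

variable [Fintype Λ]

/-- Condition (i) of the theorem, where `I` is the union of the parts with label in `S` and `lo α`
is the number of arcs with tail `x` that the members with label `α` still lack. -/
def LowerCondition (F : Fin k → D.Sub) (x : W) (κ : Fin k → Λ) (lo : Λ → ℤ) : Prop :=
  ∀ (t : ℕ) (X : Fin t → Finset W) (S : Finset Λ), IsSubpartition (Finset.univ.erase x) X →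
    ∑ j, deficit F (freeArcs F) (indicesOf κ S) (X j) + ∑ α ∈ Sᶜ, lo α ≤
      ∑ u ∈ Finset.univ.erase x \ Finset.univ.biUnion X, (weight F x (indicesOf κ S)ᶜ u : ℤ)

/-- Condition (ii) of the theorem, where `I` is the union of the parts with label in `S` and `hi α`
is the number of arcs with tail `x` that the members with label `α` may still receive. -/
def UpperCondition (F : Fin k → D.Sub) (x : W) (κ : Fin k → Λ) (hi : Λ → ℤ) : Prop :=
  ∀ (t : ℕ) (X : Fin t → Finset W) (S : Finset Λ), IsSubpartition (Finset.univ.erase x) X →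
    ∑ j, deficit F (innerArcs F x) (indicesOf κ S) (X j) ≤ ∑ α ∈ S, hi α

variable {κ : Fin k → Λ} {lo hi : Λ → ℤ}

omit [Fintype W] [DecidableEq W] [Fintype A] [DecidableEq A] [Fintype Λ] in
theorem indicesOf_some_comp (κ : Fin k → Λ) (S : Finset (Option Λ)) :
    indicesOf (some ∘ κ) S = indicesOf κ S.eraseNone := by
  ext i; simp [mem_indicesOf]

theorem LowerCondition.packing_le (hlower : LowerCondition F x κ lo) (hF : ∀ i, x ∈ (F i).verts)
    {S : Finset (Option Λ)} {v : ℤ} (h : HasPacking (demand F x (some ∘ κ)) S Finset.univ v) :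
    v + ∑ o ∈ Sᶜ, Option.elim' 0 lo o ≤ ∑ u, (D.numArcs (freeArcs F) {x} {u} : ℤ) := by
  obtain ⟨t, X, hX, hv⟩ := exists_subpartition_of_hasPacking
    ((h.erase fun T X => demand_nonpos hF).mono (Finset.subset_insert none S) subset_rfl)
  have hS : (insert none S).eraseNone = S.eraseNone := by ext; simp
  have hSc : Sᶜ.eraseNone = S.eraseNoneᶜ := by ext; simp
  have hlo := hlower t X S.eraseNone hX
  have hsum := hX.sum_eq fun u => (D.numArcs (freeArcs F) {x} {u} : ℤ)
  have hdeficit : ∀ j, deficit F (innerArcs F x) (indicesOf κ S.eraseNone) (X j) =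
      deficit F (freeArcs F) (indicesOf κ S.eraseNone) (X j) +
        ∑ u ∈ X j, (D.numArcs (freeArcs F) {x} {u} : ℤ) := fun j => by
    rw [deficit_innerArcs fun hx => Finset.notMem_erase x _ (hX.subset j hx), numArcs_eq_sum,
      Nat.cast_sum]
  simp only [if_pos (Finset.mem_insert_self none S), indicesOf_some_comp, hS,
    max_zero_surplus_singleton, hdeficit, Finset.sum_sub_distrib, Finset.sum_add_distrib] at hv
  rw [← Finset.sum_eraseNone, hSc, ← Finset.add_sum_erase _ _ (Finset.mem_univ x), numArcs_self]
  linarith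

theorem UpperCondition.dominatesPackings (hupper : UpperCondition F x κ hi) (hhi : 0 ≤ hi)
    (hlower : LowerCondition F x κ lo) (hF : ∀ i, x ∈ (F i).verts) :
    DominatesPackings (demand F x (some ∘ κ)) Finset.univ
      (Option.elim' (∑ u, (D.numArcs (freeArcs F) {x} {u} : ℤ)) hi) := by
  intro S v h
  by_cases hS : none ∈ S
  · have hv := hlower.packing_le hF (h.mono (Finset.subset_univ S) subset_rfl)
    rw [Finset.compl_univ, Finset.sum_empty, add_zero] at hv
    rw [← Finset.add_sum_erase _ _ hS]
    refine hv.trans (le_add_of_nonneg_right (Finset.sum_nonneg fun o ho => ?_))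
    obtain ⟨α, rfl⟩ := Option.ne_none_iff_exists'.1 (Finset.ne_of_mem_erase ho)
    exact hhi α
  · obtain ⟨t, X, hX, hv⟩ :=
      exists_subpartition_of_hasPacking (h.erase fun T X => demand_nonpos hF)
    have hup := hupper t X S.eraseNone hX
    rw [if_neg hS, add_zero, indicesOf_some_comp] at hv
    rw [← Finset.erase_eq_of_notMem hS, ← Finset.map_some_eraseNone, Finset.sum_map]
    exact hv.trans hup

omit [Fintype W] [DecidableEq W] [DecidableEq Λ] [Fintype Λ] in
theorem blockSum_submatrix_some (m : Matrix (Option Λ) W ℕ) (S : Finset Λ) (X : Finset W) :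
    blockSum (m.submatrix some id) S X = blockSum m (S.map Function.Embedding.some) X := by
  simp [blockSum, Finset.sum_product]

theorem isRootPlan_submatrix_some {m : Matrix (Option Λ) W ℕ}
    (hcol : ∀ u, blockSum m Finset.univ {u} = D.numArcs (freeArcs F) {x} {u})
    (hcov : ∀ S, ∀ X : Finset W, X.Nonempty → demand F x (some ∘ κ) S X ≤ blockSum m S X) :
    IsRootPlan F x κ (m.submatrix some id) where
  covers S X hX := by
    have hle := deficit_le_demand.trans (hcov (S.map Function.Embedding.some) X hX)
    rwa [indicesOf_some_comp, Finset.eraseNone_map_some, ← blockSum_submatrix_some] at hle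
  le_missing α u := by
    have hle := (surplus_le_demand (F := F) (x := x) (κ := some ∘ κ) (S := {some α}ᶜ)
      (by simp) (Finset.card_singleton u)).trans (hcov _ {u} (Finset.singleton_nonempty u))
    have hα : ({some α} : Finset (Option Λ)).eraseNone = {α} := by ext; simp
    have hsum :
        blockSum m {some α} {u} + blockSum m {some α}ᶜ {u} = blockSum m Finset.univ {u} := by
      simp only [blockSum, Finset.sum_product]
      exact Finset.sum_add_sum_compl _ _
    have hentry : blockSum m {some α} {u} = m (some α) u := by simp [blockSum]
    rw [surplus, ← indicesOf_compl, compl_compl, indicesOf_some_comp, hα, ← hcol] at hle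
    rw [Matrix.submatrix_apply, id]
    lia
  le_numArcs u := by
    rw [blockSum_submatrix_some, ← hcol]
    exact blockSum_mono m _ (Finset.subset_univ _)

theorem exists_isRootPlan (hF : ∀ i, x ∈ (F i).verts) (hle : lo ≤ hi) (hhi : 0 ≤ hi)
    (hlower : LowerCondition F x κ lo) (hupper : UpperCondition F x κ hi) :
    ∃ m, IsRootPlan F x κ m ∧
      ∀ α, lo α ≤ blockSum m {α} Finset.univ ∧ blockSum m {α} Finset.univ ≤ hi α := by
  set N : ℤ := ∑ u, (D.numArcs (freeArcs F) {x} {u} : ℤ)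
  have hN : 0 ≤ N := Finset.sum_nonneg fun u _ => Int.natCast_nonneg _
  obtain ⟨a, ha, hsum, hdom⟩ := exists_vector_in_box (isBisupermodular_demand (κ := some ∘ κ))
    (lo := Option.elim' 0 lo) (hi := Option.elim' N hi) (N := N) (Option.rec hN hle)
    (by
      rw [Fintype.sum_option]
      exact le_add_of_nonneg_right (Finset.sum_nonneg fun α _ => hhi α))
    (hupper.dominatesPackings hhi hlower hF) fun S v => hlower.packing_le hF
  obtain ⟨m, hrow, hcol, hcov⟩ := exists_covering_matrix isBisupermodular_demand hdom
    (fun u _ => Int.natCast_nonneg _)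
    (fun u _ => (surplus_le_demand (Finset.mem_univ none) (Finset.card_singleton u)).trans' <| by
      simp [surplus, missing, indicesOf]) hsum
  refine ⟨m.submatrix some id, isRootPlan_submatrix_some (fun u => by
    exact_mod_cast hcol u (Finset.mem_univ u)) fun S X => hcov S X (Finset.subset_univ X),
    fun α => ?_⟩
  rw [blockSum_submatrix_some, Finset.map_singleton, Function.Embedding.some_apply, hrow]
  exact ⟨ha.1 (some α), ha.2 (some α)⟩

end RootPlan

end MultiDigraph

namespace MultiDigraph

variable {W A : Type*} {D : MultiDigraph W A} {k : ℕ} {F F' : Fin k → D.Sub} {x : W}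
  {Λ : Type*} [DecidableEq Λ]

section NewArcs

variable [DecidableEq W]

theorem sum_numArcs_le {N : Fin k → Finset A} {B : Finset A}
    (hN : ∀ i j, i ≠ j → Disjoint (N i) (N j)) (hB : ∀ i, N i ⊆ B) (I : Finset (Fin k))
    (X Y : Finset W) : ∑ i ∈ I, D.numArcs (N i) X Y ≤ D.numArcs B X Y := by
  classical
  simp only [numArcs]
  rw [← Finset.card_biUnion fun i _ j _ hij => Finset.disjoint_filter_filter (hN i j hij)]
  exact Finset.card_le_card <| Finset.biUnion_subset.2 fun i _ =>
    Finset.filter_subset_filter _ (hB i)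

variable [DecidableEq A]

/-- The arcs of `F' i` that are not arcs of `F i`. -/
def newArcs (F F' : Fin k → D.Sub) (i : Fin k) : Finset A := (F' i).arcs \ (F i).arcs

/-- The number of new arcs from `x` into `X` in the members with index in `I`. -/
def numNewArcs (F F' : Fin k → D.Sub) (x : W) (I : Finset (Fin k)) (X : Finset W) : ℕ :=
  ∑ i ∈ I, D.numArcs (newArcs F F' i) {x} X

theorem numNewArcs_eq_sum (I : Finset (Fin k)) (X : Finset W) :
    numNewArcs F F' x I X = ∑ u ∈ X, numNewArcs F F' x I {u} := by
  simp only [numNewArcs, numArcs_eq_sum (Y := X)]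
  exact Finset.sum_comm

theorem sum_numNewArcs (κ : Fin k → Λ) (S : Finset Λ) (X : Finset W) :
    ∑ α ∈ S, numNewArcs F F' x (indicesOf κ {α}) X = numNewArcs F F' x (indicesOf κ S) X :=
  (sum_indicesOf κ S _).symm

theorem rootDeg_eq_add_numNewArcs [Fintype W] (hsub : ∀ i, (F i).IsSubOf (F' i))
    (I : Finset (Fin k)) :
    rootDeg F' x I = rootDeg F x I + numNewArcs F F' x I (Finset.univ.erase x) := by
  simp only [rootDeg, numNewArcs, ← Finset.sum_add_distrib]
  refine Finset.sum_congr rfl fun i _ => ?_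
  rw [← Finset.compl_singleton, ← outDeg]
  simp only [outDeg_eq_card_outArcs, outArcs, newArcs]
  rw [← Finset.card_union_of_disjoint (Finset.disjoint_filter_filter Finset.disjoint_sdiff),
    ← Finset.filter_union, Finset.union_sdiff_of_subset (hsub i).2]

end NewArcs

namespace IsSpanningExtension

variable [DecidableEq A] {I : Finset (Fin k)} {X : Finset W} {i : Fin k}

theorem disjoint_newArcs (h : IsSpanningExtension F F' x) (i j : Fin k) (hij : i ≠ j) :
    Disjoint (newArcs F F' i) (newArcs F F' j) :=
  (h.isPacking.arcDisjoint i j hij).mono Finset.sdiff_subset Finset.sdiff_subset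

theorem newArcs_subset [Fintype A] (h : IsSpanningExtension F F' x) (i : Fin k) :
    newArcs F F' i ⊆ freeArcs F := by
  intro a ha
  obtain ⟨ha, ha'⟩ := Finset.mem_sdiff.1 ha
  refine mem_freeArcs.2 fun j hj => ?_
  rcases eq_or_ne i j with rfl | hij
  · exact ha' hj
  · exact Finset.disjoint_left.1 (h.isPacking.arcDisjoint i j hij) ha ((h.isSubOf j).2 hj)

variable [DecidableEq W]

theorem numNewArcs_singleton_le_weight [Fintype A] (h : IsSpanningExtension F F' x)
    (hF : ∀ i, (F i).IsArborescence x) (I : Finset (Fin k)) (u : W) :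
    numNewArcs F F' x I {u} ≤ weight F x I u := by
  rw [weight_eq_min]
  refine le_min ?_ (sum_numArcs_le h.disjoint_newArcs h.newArcs_subset _ _ _)
  rw [missing, Finset.card_filter]
  refine Finset.sum_le_sum fun i _ => ?_
  have hmem : ∀ a ∈ (newArcs F F' i).filter fun a => D.tail a ∈ ({x} : Finset W) ∧
      D.head a ∈ ({u} : Finset W),
      a ∈ (F' i).arcs ∧ a ∉ (F i).arcs ∧ D.tail a = x ∧ D.head a = u := by
    simp [newArcs, and_assoc]
  have htree := h.isPacking.isArborescence i
  split_ifs with hu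
  · refine Finset.card_le_one.2 fun a ha b hb => ?_
    obtain ⟨haF', -, hta, hha⟩ := hmem a ha
    obtain ⟨hbF', -, htb, hhb⟩ := hmem b hb
    exact htree.2.1.1 a haF' b hbF' (by rw [hta, hha, htb, hhb])
  · refine (Finset.card_eq_zero.2 (Finset.eq_empty_iff_forall_notMem.2 fun a ha => ?_)).le
    obtain ⟨haF', haF, hta, rfl⟩ := hmem a ha
    exact hu (Finset.disjoint_singleton_left.2
      ((hF i).head_notMem htree (h.isSubOf i) haF' haF hta))

variable [Fintype W]

theorem one_le_inDeg_newArcs (h : IsSpanningExtension F F' x) (hX : X.Nonempty) (hx : x ∉ X)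
    (hi : Disjoint X (F i).verts) : 1 ≤ D.inDeg (newArcs F F' i) X := by
  obtain ⟨v, hv⟩ := hX
  obtain ⟨p, hp, -⟩ := (h.isPacking.isArborescence i).2.2 v (h.isSpanning i v)
  obtain ⟨a, ha, hta, hha⟩ := hp.1.exists_entering (X := (X : Set W)) hx hv
  have ha' : a ∉ (F i).arcs := fun h => Finset.disjoint_left.1 hi hha ((F i).head_mem a h)
  exact Finset.card_pos.2 ⟨a, Finset.mem_filter.2
    ⟨Finset.mem_sdiff.2 ⟨hp.2.1 a ha, ha'⟩, Finset.mem_compl.2 hta, hha⟩⟩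

theorem card_missing_le (h : IsSpanningExtension F F' x) (hX : X.Nonempty) (hx : x ∉ X) :
    (missing F I X).card ≤ ∑ i ∈ I, D.inDeg (newArcs F F' i) X := by
  rw [missing, Finset.card_filter]
  refine Finset.sum_le_sum fun i _ => ?_
  split_ifs with hi
  · exact h.one_le_inDeg_newArcs hX hx hi
  · exact Nat.zero_le _

variable [Fintype A]

theorem deficit_freeArcs_le (h : IsSpanningExtension F F' x) (hX : X.Nonempty) (hx : x ∉ X) :
    deficit F (freeArcs F) I X + numNewArcs F F' x Iᶜ X ≤ 0 := by
  have hmissing := h.card_missing_le (I := I) hX hx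
  have hroot : numNewArcs F F' x Iᶜ X ≤ ∑ i ∈ Iᶜ, D.inDeg (newArcs F F' i) X :=
    Finset.sum_le_sum fun i _ => (Nat.le_add_left _ _).trans_eq (inDeg_eq_add_numArcs hx).symm
  have hfree : ∑ i, D.inDeg (newArcs F F' i) X ≤ D.inDeg (freeArcs F) X :=
    sum_numArcs_le h.disjoint_newArcs h.newArcs_subset _ _ _
  rw [← Finset.sum_add_sum_compl I] at hfree
  rw [deficit]
  lia

theorem deficit_innerArcs_le (h : IsSpanningExtension F F' x) (hX : X.Nonempty) (hx : x ∉ X) :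
    deficit F (innerArcs F x) I X ≤ numNewArcs F F' x I X := by
  have hmissing := h.card_missing_le (I := I) hX hx
  have hinner : ∑ i ∈ I, D.inDeg (newArcs F F' i \ D.outArcs Finset.univ x) X ≤
      D.inDeg (innerArcs F x) X :=
    sum_numArcs_le (fun i j hij => (h.disjoint_newArcs i j hij).mono Finset.sdiff_subset
      Finset.sdiff_subset) (fun i => Finset.sdiff_subset_sdiff (h.newArcs_subset i) subset_rfl) ..
  simp only [inDeg_eq_add_numArcs (B := newArcs F F' _) hx, Finset.sum_add_distrib] at hmissing
  rw [deficit, numNewArcs]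
  lia

variable {κ : Fin k → Λ} {lo hi : Λ → ℤ}

theorem lowerCondition [Fintype Λ] (h : IsSpanningExtension F F' x)
    (hF : ∀ i, (F i).IsArborescence x)
    (hlo : ∀ α, lo α ≤ (rootDeg F' x (indicesOf κ {α}) : ℤ) - rootDeg F x (indicesOf κ {α})) :
    LowerCondition F x κ lo := by
  intro t X S hX
  have hroot : ∑ α ∈ Sᶜ, lo α ≤ numNewArcs F F' x (indicesOf κ S)ᶜ (Finset.univ.erase x) := by
    rw [← indicesOf_compl, ← sum_numNewArcs, Nat.cast_sum]
    refine Finset.sum_le_sum fun α _ => (hlo α).trans_eq ?_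
    rw [rootDeg_eq_add_numNewArcs h.isSubOf, Nat.cast_add, add_sub_cancel_left]
  have hdeficit : ∀ j, deficit F (freeArcs F) (indicesOf κ S) (X j) +
      ∑ u ∈ X j, (numNewArcs F F' x (indicesOf κ S)ᶜ {u} : ℤ) ≤ 0 := fun j => by
    have := h.deficit_freeArcs_le (I := indicesOf κ S) (hX.nonempty j)
      fun hx => Finset.notMem_erase x _ (hX.subset j hx)
    rwa [numNewArcs_eq_sum, Nat.cast_sum] at this
  have hdeficit := Finset.sum_nonpos fun j (_ : j ∈ Finset.univ) => hdeficit j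
  have hweight := Finset.sum_le_sum fun u (_ : u ∈ Finset.univ.erase x \ Finset.univ.biUnion X) =>
    Nat.cast_le (α := ℤ).2 (h.numNewArcs_singleton_le_weight hF (indicesOf κ S)ᶜ u)
  rw [numNewArcs_eq_sum, Nat.cast_sum, hX.sum_eq] at hroot
  rw [Finset.sum_add_distrib] at hdeficit
  linarith

theorem upperCondition (h : IsSpanningExtension F F' x)
    (hhi : ∀ α, (rootDeg F' x (indicesOf κ {α}) : ℤ) - rootDeg F x (indicesOf κ {α}) ≤ hi α) :
    UpperCondition F x κ hi := by
  intro t X S hX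
  have hroot : (numNewArcs F F' x (indicesOf κ S) (Finset.univ.erase x) : ℤ) ≤ ∑ α ∈ S, hi α := by
    rw [← sum_numNewArcs, Nat.cast_sum]
    refine Finset.sum_le_sum fun α _ => (hhi α).trans_eq' ?_
    rw [rootDeg_eq_add_numNewArcs h.isSubOf, Nat.cast_add, add_sub_cancel_left]
  rw [numNewArcs_eq_sum, Nat.cast_sum, hX.sum_eq] at hroot
  refine le_trans ?_ ((le_add_of_nonneg_right
    (Finset.sum_nonneg fun u _ => Int.natCast_nonneg _)).trans hroot)
  refine Finset.sum_le_sum fun j _ => ?_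
  rw [← Nat.cast_sum, ← numNewArcs_eq_sum]
  exact h.deficit_innerArcs_le (hX.nonempty j) fun hx => Finset.notMem_erase x _ (hX.subset j hx)

end IsSpanningExtension

variable [Fintype W] [DecidableEq W] [Fintype A] [DecidableEq A] [Fintype Λ] {κ : Fin k → Λ}
  {lo hi : Λ → ℤ}

theorem rootDeg_eq_of_subset_union (hsub : ∀ i, (F i).IsSubOf (F' i))
    (h : ∀ i, (F' i).arcs ⊆ (F i).arcs ∪ innerArcs F x) (I : Finset (Fin k)) :
    rootDeg F' x I = rootDeg F x I := by
  have hzero : ∀ i, D.numArcs (newArcs F F' i) {x} (Finset.univ.erase x) = 0 := fun i => by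
    refine Finset.card_eq_zero.2 (Finset.filter_eq_empty_iff.2 fun a ha hax => ?_)
    have ha := sdiff_le_iff.2 (h i) ha
    exact (mem_innerArcs.1 ha).2 (Finset.mem_singleton.1 hax.1)
  rw [rootDeg_eq_add_numNewArcs hsub, numNewArcs, Finset.sum_eq_zero fun i _ => hzero i, add_zero]

theorem IsRootPlan.exists_isSpanningExtension {m : Matrix Λ W ℕ} (hm : IsRootPlan F x κ m)
    (hF : IsArborescencePacking F x) :
    ∃ F', IsSpanningExtension F F' x ∧ ∀ S, rootDeg F' x (indicesOf κ S) =
      rootDeg F x (indicesOf κ S) + blockSum m S Finset.univ := by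
  obtain ⟨F₁, hF₁, hsub₁, hcov, hdeg⟩ := exists_root_extension hF hm
  obtain ⟨F', hF', harcs⟩ := MultiDigraph.exists_isSpanningExtension hF₁ Finset.sdiff_subset hcov
  refine ⟨F', ⟨hF'.isPacking, hF'.isSpanning, fun i => (hsub₁ i).trans (hF'.isSubOf i)⟩,
    fun S => ?_⟩
  rw [rootDeg_eq_of_subset_union hF'.isSubOf harcs, hdeg]

theorem exists_isSpanningExtension_iff (hF : IsArborescencePacking F x) (hle : lo ≤ hi)
    (hhi : 0 ≤ hi) :
    (∃ F', IsSpanningExtension F F' x ∧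
        ∀ α, lo α ≤ (rootDeg F' x (indicesOf κ {α}) : ℤ) - rootDeg F x (indicesOf κ {α}) ∧
          (rootDeg F' x (indicesOf κ {α}) : ℤ) - rootDeg F x (indicesOf κ {α}) ≤ hi α) ↔
      LowerCondition F x κ lo ∧ UpperCondition F x κ hi := by
  constructor
  · rintro ⟨F', h, hdeg⟩
    exact ⟨h.lowerCondition hF.isArborescence fun α => (hdeg α).1,
      h.upperCondition fun α => (hdeg α).2⟩
  · rintro ⟨hlower, hupper⟩
    obtain ⟨m, hm, hdeg⟩ :=
      exists_isRootPlan (fun i => (hF.isArborescence i).1) hle hhi hlower hupper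
    obtain ⟨F', h, hroot⟩ := hm.exists_isSpanningExtension hF
    refine ⟨F', h, fun α => ?_⟩
    rw [hroot, Nat.cast_add, add_sub_cancel_left]
    exact hdeg α

end MultiDigraph

section Partition

variable {ι Λ : Type*} [Fintype ι] [DecidableEq Λ] {κ : ι → Λ}

theorem exists_eq_indicesOf_singleton {part : Λ → Finset ι}
    (hdisj : ∀ α β, α ≠ β → Disjoint (part α) (part β)) (hcover : ∀ i, ∃ α, i ∈ part α) :
    ∃ κ : ι → Λ, part = fun α => indicesOf κ {α} := by
  choose κ hκ using hcover
  refine ⟨κ, funext fun α => Finset.ext fun i => ?_⟩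
  rw [mem_indicesOf, Finset.mem_singleton]
  refine ⟨fun hi => ?_, fun h => h ▸ hκ i⟩
  by_contra hne
  exact Finset.disjoint_left.1 (hdisj _ _ hne) (hκ i) hi

theorem biUnion_indicesOf_singleton [DecidableEq ι] (κ : ι → Λ) (S : Finset Λ) :
    (S.biUnion fun α => indicesOf κ {α}) = indicesOf κ S := by
  ext i; simp [mem_indicesOf]

theorem filter_indicesOf_singleton_subset [DecidableEq ι] [Fintype Λ]
    (hκ : ∀ α, (indicesOf κ {α}).Nonempty) (S : Finset Λ) :
    (Finset.univ.filter fun α => indicesOf κ {α} ⊆ indicesOf κ S) = S := by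
  ext α
  obtain ⟨i, hi⟩ := hκ α
  simp only [Finset.mem_filter, Finset.mem_univ, true_and, Finset.subset_iff, mem_indicesOf,
    Finset.mem_singleton] at hi ⊢
  grind

end Partition

namespace MultiDigraph

variable {W A : Type*} {D : MultiDigraph W A} {k : ℕ} {x : W}

theorem isSpanningExtension_iff {F F' : Fin k → D.Sub} : IsSpanningExtension F F' x ↔
    (∀ i, (F i).IsSubOf (F' i)) ∧ (∀ i, (F' i).IsArborescence x ∧ (F' i).IsSpanning) ∧
      ArcDisjoint F' :=
  ⟨fun h => ⟨h.isSubOf, fun i => ⟨h.isPacking.isArborescence i, h.isSpanning i⟩,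
    h.isPacking.arcDisjoint⟩, fun ⟨hsub, h, hdisj⟩ =>
    ⟨⟨fun i => (h i).1, hdisj⟩, fun i => (h i).2, hsub⟩⟩

theorem forall_isSubpartition_erase_iff [Fintype W] [DecidableEq W] {Λ : Type*} [DecidableEq Λ]
    {κ : Fin k → Λ} {P : (t : ℕ) → (Fin t → Finset W) → Finset (Fin k) → Prop} :
    (∀ (t : ℕ) (X : Fin t → Finset W) (I : Finset (Fin k)),
        (∀ j, (X j).Nonempty ∧ x ∉ X j) → (∀ j j', j ≠ j' → Disjoint (X j) (X j')) →
        (∃ S : Finset Λ, I = S.biUnion fun α => indicesOf κ {α}) → P t X I) ↔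
      ∀ (t : ℕ) (X : Fin t → Finset W) (S : Finset Λ),
        IsSubpartition (Finset.univ.erase x) X → P t X (indicesOf κ S) := by
  simp only [biUnion_indicesOf_singleton]
  refine ⟨fun h t X S hX => h t X _ (fun j => ⟨hX.nonempty j, fun hx =>
    Finset.notMem_erase x _ (hX.subset j hx)⟩) hX.disjoint ⟨S, rfl⟩, ?_⟩
  rintro h t X _ hX hdisj ⟨S, rfl⟩
  exact h t X S ⟨fun j => (hX j).1, fun j => Finset.subset_erase.2
    ⟨Finset.subset_univ _, (hX j).2⟩, hdisj⟩

end MultiDigraph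

theorem theorem1p10 {W A : Type*} [Fintype W] [DecidableEq W] [Fintype A] [DecidableEq A]
    -- the digraph `D = (V + x, A)`, where `V + x` is the type `W`
    (D : MultiDigraph W A) (x : W) (k : ℕ) (hk : 0 < k)
    -- the partition `I_1, …, I_l` of `[k]`
    (l : ℕ) (part : Fin l → Finset (Fin k))
    (hpart_nonempty : ∀ α, (part α).Nonempty)
    (hpart_disjoint : ∀ α β, α ≠ β → Disjoint (part α) (part β))
    (hpart_cover : ∀ i : Fin k, ∃ α, i ∈ part α)
    -- the lower bounds `c` and the upper bounds `c'`
    (c c' : Fin l → ℕ) (hcc' : ∀ α, c α ≤ c' α)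
    -- the arc-disjoint `x`-arborescences `F_1, …, F_k`
    (F : Fin k → D.Sub) (hF : ∀ i, (F i).IsArborescence x)
    (hF_disjoint : MultiDigraph.ArcDisjoint F)
    (hF_deg : ∀ α, ∑ i ∈ part α, D.outDeg (F i).arcs x ≤ c' α) :
    (∃ F' : Fin k → D.Sub,
        (∀ i, (F i).IsSubOf (F' i)) ∧
        (∀ i, (F' i).IsArborescence x ∧ (F' i).IsSpanning) ∧
        MultiDigraph.ArcDisjoint F' ∧
        ∀ α, c α ≤ ∑ i ∈ part α, D.outDeg (F' i).arcs x ∧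
          ∑ i ∈ part α, D.outDeg (F' i).arcs x ≤ c' α) ↔
      -- for all disjoint nonempty `X_1, …, X_t ⊆ V` and every union `I` of some of the parts
      ∀ (t : ℕ) (X : Fin t → Finset W) (I : Finset (Fin k)),
        (∀ j, (X j).Nonempty ∧ x ∉ X j) →
        (∀ j j', j ≠ j' → Disjoint (X j) (X j')) →
        (∃ S : Finset (Fin l), I = S.biUnion part) →
        ((∑ j, (D.inDeg (MultiDigraph.freeArcs F) (X j) : ℤ) ≥
            ∑ j, ((MultiDigraph.missing F I (X j)).card : ℤ)
              + ∑ α with part α ⊆ Iᶜ,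
                  ((c α : ℤ) - ∑ i ∈ part α, (D.outDeg (F i).arcs x : ℤ))
              - ∑ u ∈ (Finset.univ.erase x) \ Finset.univ.biUnion X,
                  (MultiDigraph.weight F x Iᶜ u : ℤ)) ∧
          (∑ j, (((MultiDigraph.missing F I (X j)).card : ℤ)
                - D.inDeg (MultiDigraph.freeArcs F \ D.outArcs Finset.univ x) (X j)) ≤
            ∑ α with part α ⊆ I,
              ((c' α : ℤ) - ∑ i ∈ part α, (D.outDeg (F i).arcs x : ℤ)))) := by
  obtain ⟨κ, rfl⟩ := exists_eq_indicesOf_singleton hpart_disjoint hpart_cover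
  have hiff := MultiDigraph.exists_isSpanningExtension_iff (κ := κ) ⟨hF, hF_disjoint⟩
    (lo := fun α => (c α : ℤ) - MultiDigraph.rootDeg F x (indicesOf κ {α}))
    (hi := fun α => (c' α : ℤ) - MultiDigraph.rootDeg F x (indicesOf κ {α}))
    (fun α => sub_le_sub_right (Nat.cast_le.2 (hcc' α)) _)
    (fun α => sub_nonneg.2 (Nat.cast_le.2 (hF_deg α)))
  simp only [MultiDigraph.isSpanningExtension_iff, sub_le_sub_iff_right, Nat.cast_le,
    and_assoc] at hiff
  refine hiff.trans ?_
  rw [MultiDigraph.forall_isSubpartition_erase_iff]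
  simp only [← indicesOf_compl, filter_indicesOf_singleton_subset hpart_nonempty, forall_and]
  refine and_congr (forall₄_congr fun t X S _ => ?_) (forall₄_congr fun t X S _ => ?_)
  · simp only [MultiDigraph.deficit, MultiDigraph.rootDeg, Finset.sum_sub_distrib, Nat.cast_sum,
      indicesOf_compl]
    constructor <;> intro h <;> linarith
  · simp only [MultiDigraph.deficit, MultiDigraph.innerArcs, MultiDigraph.rootDeg, Nat.cast_sum]
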